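/- Let $k$ be an algebraically closed field of characteristic zero, $G$ a group, $a\in Z(G)$, and $\chi:G\to k^\times$ a character of finite order $s$ such that $\chi(a)\neq 1$ and $q=\chi^{-1}(a)$ is a primitive $s$-th root of unity. Let $H=kG(\chi^{-1},a,0)$ be the Hopf algebra generated as an algebra by the group algebra $kG$ and an element $x$ subject to $xg=\chi^{-1}(g)\,gx$ for $g\in G$, with $$\Delta(g)=g\otimes g,\quad \Delta(x)=x\otimes a+1\otimes x,\quad \varepsilon(g)=1,\quad \varepsilon(x)=0,\quad S(g)=g^{-1},\quad S(x)=-xa^{-1}\qquad(g\in G).$$ For a character $\lambda:G\to k^\times$, $n\ge 1$ and $\beta\in k$, write $(y-\beta)^n=y^n-\sum_{j=0}^{n-1}\alpha_jy^j$ and let $V_n(\lambda,\beta)$ be the $H$-module with $k$-basis $m_0,\dots,m_{ns-1}$ and action $$g\cdot m_i=\chi^i(g)\lambda(g)m_i,\qquad x\cdot m_i=m_{i+1}\ (0\le i\le ns-2),\qquad x\cdot m_{ns-1}=\sum_{j=0}^{n-1}\alpha_j m_{js};$$ it is said to be of non-nilpotent type if $\beta\neq 0$. For $n\ge 1$ let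 $V_n(\lambda)$, the module of nilpotent type, be the $H$-module with $k$-basis $m_0,\dots,m_{n-1}$ and action $g\cdot m_i=\chi^i(g)\lambda(g)m_i$, $x\cdot m_i=m_{i+1}$ for $0\le i\le n-2$, and $x\cdot m_{n-1}=0$. Tensor products are taken over $k$, with $H$ acting through $\Delta$. **Theorem.** Let $p,t\ge 1$ be integers, $\sigma,\lambda:G\to k^\times$ characters and $\alpha,\beta\in k^\times$. Then, as $H$-modules, $$V_p(\sigma,\alpha)\otimes V_t(\lambda,\beta)\;\cong\;\bigoplus_{i=0}^{s-1}\ \bigoplus_{j=1}^{\min\{p,t\}} V_{2j-1+|p-t|}\bigl(\chi^i\sigma\lambda,\ \alpha\lambda^s(a)+\beta\bigr).$$ If $\alpha\lambda^s(a)+\beta=0$, the summands are modules of nilpotent type: $$V_{2j-1+|p-t|}\bigl(\chi^i\sigma\lambda,\ \alpha\lambda^s(a)+\beta\bigr)\cong V_{(2j-1+|p-t|)s}(\chi^i\sigma\lambda)\qquad\text{for all }0\le i\le s-1,\ 1\le j\le\min\{p,t\}.$$ -/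

import Mathlib

open scoped TensorProduct DirectSum

noncomputable section

/-- Free generators of the Hopf-Ore extension: the elements of `G` and one further letter `x`. -/
inductive HopfOreGen (G : Type*) where
  | grp (g : G) : HopfOreGen G
  | x : HopfOreGen G

/-- The defining relations of `H = kG(χ⁻¹, a, 0)`: those of the group algebra `kG`, together with
`x g = χ⁻¹(g) g x` for all `g ∈ G`. -/
inductive HopfOreRel {k G : Type*} [Field k] [Group G] (χ : G →* kˣ) :
    FreeAlgebra k (HopfOreGen G) → FreeAlgebra k (HopfOreGen G) → Prop
  | one : HopfOreRel χ (FreeAlgebra.ι k (.grp 1)) 1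
  | mul (g h : G) : HopfOreRel χ (FreeAlgebra.ι k (.grp g) * FreeAlgebra.ι k (.grp h))
      (FreeAlgebra.ι k (.grp (g * h)))
  | comm (g : G) : HopfOreRel χ (FreeAlgebra.ι k .x * FreeAlgebra.ι k (.grp g))
      (((χ⁻¹ g : kˣ) : k) • (FreeAlgebra.ι k (.grp g) * FreeAlgebra.ι k .x))

/-- The Hopf-Ore extension `kG(χ⁻¹, a, 0)` of the group algebra `kG`, as an algebra. The central
element `a` only enters the coalgebra structure below. -/
def HopfOre {k G : Type*} [Field k] [Group G] (χ : G →* kˣ) (_a : Subgroup.center G) :=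
  RingQuot (HopfOreRel χ)

namespace HopfOre

variable {k G : Type*} [Field k] [Group G] (χ : G →* kˣ) (a : Subgroup.center G)

instance : Ring (HopfOre χ a) := inferInstanceAs (Ring (RingQuot (HopfOreRel χ)))

instance : Algebra k (HopfOre χ a) := inferInstanceAs (Algebra k (RingQuot (HopfOreRel χ)))

/-- The generator of `H` given by the group element `g`. -/
def of (g : G) : HopfOre χ a := RingQuot.mkAlgHom k (HopfOreRel χ) (FreeAlgebra.ι k (.grp g))

/-- The generator `x` of `H`. -/
def X : HopfOre χ a := RingQuot.mkAlgHom k (HopfOreRel χ) (FreeAlgebra.ι k .x)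

theorem of_one : of χ a 1 = 1 :=
  (RingQuot.mkAlgHom_rel k (HopfOreRel.one (χ := χ))).trans (map_one _)

theorem of_mul (g h : G) : of χ a g * of χ a h = of χ a (g * h) :=
  (map_mul _ _ _).symm.trans (RingQuot.mkAlgHom_rel k (HopfOreRel.mul (χ := χ) g h))

theorem X_mul_of (g : G) :
    X χ a * of χ a g = ((χ⁻¹ g : kˣ) : k) • (of χ a g * X χ a) := by
  have h := RingQuot.mkAlgHom_rel k (HopfOreRel.comm (χ := χ) g)
  rw [map_mul, map_smul, map_mul] at h
  exact h

/-- The universal property of `H`. -/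
def lift {B : Type*} [Ring B] [Algebra k B] (f : G → B) (y : B) (h1 : f 1 = 1)
    (hm : ∀ g h, f g * f h = f (g * h))
    (hc : ∀ g, y * f g = ((χ⁻¹ g : kˣ) : k) • (f g * y)) : HopfOre χ a →ₐ[k] B :=
  RingQuot.liftAlgHom k ⟨FreeAlgebra.lift k (fun i => match i with | .grp g => f g | .x => y), by
    intro u v huv
    cases huv with
    | one => simpa using h1
    | mul g h => simpa using hm g h
    | comm g => simpa using hc g⟩

section lift

variable {χ a} {B : Type*} [Ring B] [Algebra k B] {f : G → B} {y : B} {h1 : f 1 = 1}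
    {hm : ∀ g h, f g * f h = f (g * h)}
    {hc : ∀ g, y * f g = ((χ⁻¹ g : kˣ) : k) • (f g * y)}

@[simp] theorem lift_of (g : G) : lift χ a f y h1 hm hc (of χ a g) = f g := by
  have := RingQuot.liftAlgHom_mkAlgHom_apply k
    (FreeAlgebra.lift k (fun i : HopfOreGen G => match i with | .grp g => f g | .x => y))
    (s := HopfOreRel χ) (by
      intro u v huv
      cases huv with
      | one => simpa using h1
      | mul g h => simpa using hm g h
      | comm g => simpa using hc g) (FreeAlgebra.ι k (.grp g))
  exact this.trans (FreeAlgebra.lift_ι_apply _ _)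

@[simp] theorem lift_X : lift χ a f y h1 hm hc (X χ a) = y := by
  have := RingQuot.liftAlgHom_mkAlgHom_apply k
    (FreeAlgebra.lift k (fun i : HopfOreGen G => match i with | .grp g => f g | .x => y))
    (s := HopfOreRel χ) (by
      intro u v huv
      cases huv with
      | one => simpa using h1
      | mul g h => simpa using hm g h
      | comm g => simpa using hc g) (FreeAlgebra.ι k .x)
  exact this.trans (FreeAlgebra.lift_ι_apply _ _)

end lift

variable {χ a} in
theorem algHom_ext {B : Type*} [Ring B] [Algebra k B] {φ ψ : HopfOre χ a →ₐ[k] B}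
    (hg : ∀ g, φ (of χ a g) = ψ (of χ a g)) (hx : φ (X χ a) = ψ (X χ a)) : φ = ψ := by
  refine RingQuot.ringQuot_ext' k φ ψ (FreeAlgebra.hom_ext (funext fun i => ?_))
  cases i with
  | grp g => exact hg g
  | x => exact hx

variable {χ a} in
theorem induction_on {C : HopfOre χ a → Prop} (u : HopfOre χ a)
    (hr : ∀ r : k, C (algebraMap k _ r)) (hg : ∀ g, C (of χ a g)) (hx : C (X χ a))
    (hmul : ∀ u v, C u → C v → C (u * v)) (hadd : ∀ u v, C u → C v → C (u + v)) : C u := by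
  obtain ⟨w, rfl⟩ := RingQuot.mkAlgHom_surjective k (HopfOreRel χ) u
  induction w using FreeAlgebra.induction with
  | grade0 r => rw [AlgHom.commutes]; exact hr r
  | grade1 i =>
    cases i with
    | grp g => exact hg g
    | x => exact hx
  | mul u v hu hv => rw [map_mul]; exact hmul _ _ hu hv
  | add u v hu hv => rw [map_add]; exact hadd _ _ hu hv

theorem of_mul_center (g : G) : of χ a a * of χ a g = of χ a g * of χ a a := by
  rw [of_mul, of_mul, Subgroup.mem_center_iff.mp a.2 g]

/-- `Δ(g) = g ⊗ g`, `Δ(x) = x ⊗ a + 1 ⊗ x`. -/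
def comulHom : HopfOre χ a →ₐ[k] HopfOre χ a ⊗[k] HopfOre χ a :=
  lift χ a (fun g => of χ a g ⊗ₜ of χ a g) (X χ a ⊗ₜ of χ a a + 1 ⊗ₜ X χ a)
    (by rw [of_one]; rfl)
    (fun g h => by rw [Algebra.TensorProduct.tmul_mul_tmul, of_mul])
    (fun g => by
      rw [add_mul, mul_add, smul_add]
      simp only [Algebra.TensorProduct.tmul_mul_tmul, X_mul_of, of_mul_center, one_mul, mul_one,
        TensorProduct.tmul_smul, TensorProduct.smul_tmul'])

/-- `ε(g) = 1`, `ε(x) = 0`. -/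
def counitHom : HopfOre χ a →ₐ[k] k :=
  lift χ a (fun _ => 1) 0 rfl (by simp) (by simp)

/-- `S(g) = g⁻¹`, `S(x) = -x a⁻¹`, as an algebra map into the opposite algebra. -/
def antipodeHom : HopfOre χ a →ₐ[k] (HopfOre χ a)ᵐᵒᵖ :=
  lift χ a (fun g => MulOpposite.op (of χ a g⁻¹))
    (MulOpposite.op (-(X χ a * of χ a (a : G)⁻¹)))
    (by rw [inv_one, of_one]; rfl)
    (fun g h => by rw [← MulOpposite.op_mul, of_mul, mul_inv_rev])
    (fun g => by
      rw [← MulOpposite.op_mul, ← MulOpposite.op_mul, ← MulOpposite.op_smul]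
      congr 1
      have hc : of χ a (a : G)⁻¹ * of χ a g⁻¹ = of χ a g⁻¹ * of χ a (a : G)⁻¹ := by
        rw [of_mul, of_mul, Subgroup.mem_center_iff.mp (inv_mem a.2) g⁻¹]
      rw [mul_neg, neg_mul, smul_neg, mul_assoc, hc, ← mul_assoc, ← mul_assoc, X_mul_of,
        smul_mul_assoc, smul_smul, ← Units.val_mul, ← map_mul, mul_inv_cancel, map_one,
        Units.val_one, one_smul])

instance : Bialgebra k (HopfOre χ a) :=
  Bialgebra.ofAlgHom (comulHom χ a) (counitHom χ a)
    (algHom_ext (fun g => by simp [comulHom])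
      (by simp [comulHom, TensorProduct.add_tmul, TensorProduct.tmul_add,
            Algebra.TensorProduct.one_def, add_assoc]))
    (algHom_ext (fun g => by simp [comulHom, counitHom]) (by simp [comulHom, counitHom]))
    (algHom_ext (fun g => by simp [comulHom, counitHom]) (by simp [comulHom, counitHom]))

theorem comul_of (g : G) :
    Coalgebra.comul (R := k) (of χ a g) = of χ a g ⊗ₜ[k] of χ a g :=
  lift_of (χ := χ) (a := a) g

theorem comul_X :
    Coalgebra.comul (R := k) (X χ a) = X χ a ⊗ₜ[k] of χ a a + 1 ⊗ₜ[k] X χ a :=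
  lift_X (χ := χ) (a := a)

theorem counit_of (g : G) : Coalgebra.counit (R := k) (of χ a g) = 1 :=
  lift_of (χ := χ) (a := a) g

theorem counit_X : Coalgebra.counit (R := k) (X χ a) = 0 :=
  lift_X (χ := χ) (a := a)

/-- The antipode as a linear map. -/
def antipodeLin : HopfOre χ a →ₗ[k] HopfOre χ a :=
  (MulOpposite.opLinearEquiv k).symm.toLinearMap ∘ₗ (antipodeHom χ a).toLinearMap

theorem antipodeLin_of (g : G) : antipodeLin χ a (of χ a g) = of χ a g⁻¹ := by
  simp [antipodeLin, antipodeHom]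

theorem antipodeLin_X : antipodeLin χ a (X χ a) = -(X χ a * of χ a (a : G)⁻¹) := by
  simp [antipodeLin, antipodeHom]

theorem antipodeLin_mul (u v : HopfOre χ a) :
    antipodeLin χ a (u * v) = antipodeLin χ a v * antipodeLin χ a u := by
  simp [antipodeLin]

theorem antipodeLin_one : antipodeLin χ a 1 = 1 := by
  simp [antipodeLin]

theorem antipode_left (u : HopfOre χ a) :
    LinearMap.mul' k _ ((antipodeLin χ a).rTensor _ (Coalgebra.comul u)) =
      algebraMap k _ (Coalgebra.counit u) := by
  have key : ∀ (c : k) (y z : HopfOre χ a ⊗[k] HopfOre χ a),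
      LinearMap.mul' k _ ((antipodeLin χ a).rTensor _ y) = algebraMap k _ c →
      LinearMap.mul' k _ ((antipodeLin χ a).rTensor _ (y * z)) =
        c • LinearMap.mul' k _ ((antipodeLin χ a).rTensor _ z) := by
    intro c y z hy
    induction z with
    | zero => simp
    | add z w hz hw => rw [mul_add, map_add, map_add, hz, hw, map_add, map_add, smul_add]
    | tmul z w =>
      have : ∀ y : HopfOre χ a ⊗[k] HopfOre χ a,
          LinearMap.mul' k _ ((antipodeLin χ a).rTensor _ (y * (z ⊗ₜ w))) =
          antipodeLin χ a z * LinearMap.mul' k _ ((antipodeLin χ a).rTensor _ y) * w := by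
        intro y
        induction y with
        | zero => simp
        | add y y' h h' => rw [add_mul, map_add, map_add, h, h', map_add, map_add, mul_add, add_mul]
        | tmul u v => simp [antipodeLin_mul, mul_assoc]
      rw [this, hy, ← Algebra.commutes, mul_assoc, ← Algebra.smul_def]
      simp
  induction u using induction_on with
  | hr r => simp [Algebra.algebraMap_eq_smul_one,
      antipodeLin_one, Bialgebra.counit_one, Bialgebra.comul_one, Algebra.TensorProduct.one_def]
  | hg g => simp [comul_of, counit_of, antipodeLin_of, of_mul, of_one]
  | hx => simp [comul_X, counit_X, antipodeLin_X, antipodeLin_one, of_mul, of_one, mul_assoc]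
  | hmul u v hu hv =>
    rw [Bialgebra.comul_mul, key _ _ _ hu, hv, Bialgebra.counit_mul, map_mul, Algebra.smul_def]
  | hadd u v hu hv => simp only [map_add, hu, hv]

theorem antipode_right (u : HopfOre χ a) :
    LinearMap.mul' k _ ((antipodeLin χ a).lTensor _ (Coalgebra.comul u)) =
      algebraMap k _ (Coalgebra.counit u) := by
  have key : ∀ (c : k) (y z : HopfOre χ a ⊗[k] HopfOre χ a),
      LinearMap.mul' k _ ((antipodeLin χ a).lTensor _ z) = algebraMap k _ c →
      LinearMap.mul' k _ ((antipodeLin χ a).lTensor _ (y * z)) =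
        c • LinearMap.mul' k _ ((antipodeLin χ a).lTensor _ y) := by
    intro c y z hz
    induction y with
    | zero => simp
    | add y w hy hw => rw [add_mul, map_add, map_add, hy, hw, map_add, map_add, smul_add]
    | tmul y w =>
      have : ∀ z : HopfOre χ a ⊗[k] HopfOre χ a,
          LinearMap.mul' k _ ((antipodeLin χ a).lTensor _ ((y ⊗ₜ w) * z)) =
          y * LinearMap.mul' k _ ((antipodeLin χ a).lTensor _ z) * antipodeLin χ a w := by
        intro z
        induction z with
        | zero => simp
        | add y y' h h' => rw [mul_add, map_add, map_add, h, h', map_add, map_add, mul_add, add_mul]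
        | tmul u v => simp [antipodeLin_mul, mul_assoc]
      rw [this, hz, ← Algebra.commutes, mul_assoc, ← Algebra.smul_def]
      simp
  induction u using induction_on with
  | hr r => simp [Algebra.algebraMap_eq_smul_one,
      antipodeLin_one, Bialgebra.counit_one, Bialgebra.comul_one, Algebra.TensorProduct.one_def]
  | hg g => simp [comul_of, counit_of, antipodeLin_of, of_mul, of_one]
  | hx => simp [comul_X, counit_X, antipodeLin_X, antipodeLin_of]
  | hmul u v hu hv =>
    rw [Bialgebra.comul_mul, key _ _ _ hv, hu, Bialgebra.counit_mul, mul_comm, map_mul,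
      Algebra.smul_def]
  | hadd u v hu hv => simp only [map_add, hu, hv]

instance : HopfAlgebra k (HopfOre χ a) where
  antipode := antipodeLin χ a
  mul_antipode_rTensor_comul := LinearMap.ext fun u => antipode_left χ a u
  mul_antipode_lTensor_comul := LinearMap.ext fun u => antipode_right χ a u

/-- Multiplication of the `i`-th coordinate by `(χ^i λ)(g)`, i.e. `g · m_i = χ^i(g) λ(g) m_i`. -/
def grpAct (μ : G →* kˣ) (N : ℕ) (g : G) : (Fin N → k) →ₗ[k] (Fin N → k) :=
  LinearMap.pi fun i => (((χ ^ (i : ℕ) * μ) g : kˣ) : k) • LinearMap.proj i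

/-- `x · m_i = m_{i+1}` for `i + 1 < N` and `x · m_{N-1} = w`, for the standard basis
`m_0, …, m_{N-1}` of `k^N`. -/
def xAct (N : ℕ) (w : Fin N → k) : (Fin N → k) →ₗ[k] (Fin N → k) :=
  (Pi.basisFun k (Fin N)).constr k fun i =>
    if h : (i : ℕ) + 1 < N then Pi.single ⟨(i : ℕ) + 1, h⟩ 1 else w

theorem grpAct_single (μ : G →* kˣ) (N : ℕ) (g : G) (i : Fin N) :
    grpAct χ μ N g (Pi.single i 1) = (((χ ^ (i : ℕ) * μ) g : kˣ) : k) • Pi.single i (1 : k) := by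
  ext j
  by_cases h : j = i
  · subst h; simp [grpAct]
  · simp [grpAct, Pi.single_eq_of_ne h]

theorem xAct_single (N : ℕ) (w : Fin N → k) (i : Fin N) :
    xAct N w (Pi.single i 1) = if h : (i : ℕ) + 1 < N then Pi.single ⟨(i : ℕ) + 1, h⟩ 1 else w := by
  rw [xAct, ← Pi.basisFun_apply, Module.Basis.constr_basis]

/-- The representation of `H` on `k^N` given by `grpAct` and `xAct`. -/
def cyclicAct (μ : G →* kˣ) (N : ℕ) (w : Fin N → k)
    (hw : ∀ i, w i ≠ 0 → χ ^ (i : ℕ) = χ ^ N) :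
    HopfOre χ a →ₐ[k] Module.End k (Fin N → k) :=
  lift χ a (grpAct χ μ N) (xAct N w)
    (by ext i j; simp [grpAct])
    (fun g h => by ext i j; simp [grpAct]; ring)
    (fun g => by
      refine (Pi.basisFun k (Fin N)).ext fun i => ?_
      rw [Pi.basisFun_apply, Module.End.mul_apply, LinearMap.smul_apply, Module.End.mul_apply,
        grpAct_single, map_smul, xAct_single]
      split_ifs with h
      · rw [grpAct_single, smul_smul, ← Units.val_mul]
        congr 2
        simp only [MonoidHom.mul_apply, MonoidHom.pow_apply, MonoidHom.inv_apply, pow_succ]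
        rw [eq_inv_mul_iff_mul_eq, mul_comm _ (χ g), mul_assoc]
      · have hN : (i : ℕ) + 1 = N := by omega
        ext j
        by_cases hj : w j = 0
        · simp [grpAct, hj]
        · have e : (χ ^ (i : ℕ) * μ) g = χ⁻¹ g * (χ ^ (j : ℕ) * μ) g := by
            have hg := DFunLike.congr_fun (hw j hj) g
            simp only [MonoidHom.pow_apply] at hg
            simp only [MonoidHom.mul_apply, MonoidHom.pow_apply, MonoidHom.inv_apply, hg]
            rw [← congrArg (χ g ^ ·) hN, pow_succ', mul_assoc, inv_mul_cancel_left]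
          rw [e]
          simp [grpAct, mul_assoc])

/-- The module `V_t(μ)` of nilpotent type: the vector space `k^t` with standard basis
`m_0, …, m_{t-1}` and `g · m_i = χ^i(g) μ(g) m_i`, `x · m_i = m_{i+1}`, `x · m_{t-1} = 0`. -/
def NilMod (_χ : G →* kˣ) (_a : Subgroup.center G) (t : ℕ) (_μ : G →* kˣ) := Fin t → k

section NilMod

variable (t : ℕ) (μ : G →* kˣ)

instance : AddCommGroup (NilMod χ a t μ) := inferInstanceAs (AddCommGroup (Fin t → k))

instance : Module k (NilMod χ a t μ) := inferInstanceAs (Module k (Fin t → k))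

/-- The representation of `H` on `V_t(μ)`. -/
def nilAct : HopfOre χ a →ₐ[k] Module.End k (NilMod χ a t μ) :=
  cyclicAct χ a μ t 0 (fun _ h => absurd rfl h)

instance : Module (HopfOre χ a) (NilMod χ a t μ) :=
  Module.compHom _ (nilAct χ a t μ).toRingHom

instance : IsScalarTower k (HopfOre χ a) (NilMod χ a t μ) where
  smul_assoc r h v := by
    change nilAct χ a t μ (r • h) v = r • nilAct χ a t μ h v
    rw [map_smul, LinearMap.smul_apply]

end NilMod

/-- For `χ` of finite order `s` and `f = y^n - ∑_{j<n} α_j y^j` monic of degree `n`, the module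
`V(μ, f)`: the vector space `k^{ns}` with standard basis `m_0, …, m_{ns-1}` and
`g · m_i = χ^i(g) μ(g) m_i`, `x · m_i = m_{i+1}` for `i ≤ ns - 2`,
`x · m_{ns-1} = ∑_{j<n} α_j m_{js}`. -/
def PolyMod (χ : G →* kˣ) (_a : Subgroup.center G) (_μ : G →* kˣ) (f : Polynomial k) :=
  Fin (f.natDegree * orderOf χ) → k

section PolyMod

variable (μ : G →* kˣ) (f : Polynomial k)

instance : AddCommGroup (PolyMod χ a μ f) :=
  inferInstanceAs (AddCommGroup (Fin (f.natDegree * orderOf χ) → k))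

instance : Module k (PolyMod χ a μ f) :=
  inferInstanceAs (Module k (Fin (f.natDegree * orderOf χ) → k))

/-- The vector `∑_{j<n} α_j m_{js}` of `V(μ, f)`, where `α_j` is minus the `j`-th coefficient of
`f`: its `l`-th coordinate is `α_{l/s}` if `s` divides `l`, and `0` otherwise. -/
def polyVec : Fin (f.natDegree * orderOf χ) → k :=
  fun l => if orderOf χ ∣ (l : ℕ) then -f.coeff ((l : ℕ) / orderOf χ) else 0

/-- The representation of `H` on `V(μ, f)`. -/
def polyAct : HopfOre χ a →ₐ[k] Module.End k (PolyMod χ a μ f) :=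
  cyclicAct χ a μ (f.natDegree * orderOf χ) (polyVec χ f) (fun i hi => by
    have hd : orderOf χ ∣ (i : ℕ) := by
      by_contra hd
      exact hi (if_neg hd)
    rw [orderOf_dvd_iff_pow_eq_one.mp hd,
      orderOf_dvd_iff_pow_eq_one.mp (Dvd.intro_left f.natDegree rfl)])

instance : Module (HopfOre χ a) (PolyMod χ a μ f) :=
  Module.compHom _ (polyAct χ a μ f).toRingHom

instance : IsScalarTower k (HopfOre χ a) (PolyMod χ a μ f) where
  smul_assoc r h v := by
    change polyAct χ a μ f (r • h) v = r • polyAct χ a μ f h v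
    rw [map_smul, LinearMap.smul_apply]

end PolyMod

open Polynomial in
/-- `V_n(μ, β) = V(μ, (y - β)^n)`. -/
abbrev JordanMod (χ : G →* kˣ) (a : Subgroup.center G) (n : ℕ) (μ : G →* kˣ) (β : k) :=
  PolyMod χ a μ ((Polynomial.X - C β) ^ n)

end HopfOre

/-- The tensor product `V ⊗ W` over `k` of two modules over a bialgebra `H`, with `H` acting
through the comultiplication: `h · (v ⊗ w) = ∑ h₁ v ⊗ h₂ w`. -/
def BialgTensor (k H V W : Type*) [CommRing k] [Ring H] [Bialgebra k H]
    [AddCommGroup V] [Module k V] [Module H V] [IsScalarTower k H V]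
    [AddCommGroup W] [Module k W] [Module H W] [IsScalarTower k H W] := V ⊗[k] W

namespace BialgTensor

variable (k H V W : Type*) [CommRing k] [Ring H] [Bialgebra k H]
    [AddCommGroup V] [Module k V] [Module H V] [IsScalarTower k H V]
    [AddCommGroup W] [Module k W] [Module H W] [IsScalarTower k H W]

instance : AddCommGroup (BialgTensor k H V W) := inferInstanceAs (AddCommGroup (V ⊗[k] W))

instance : Module k (BialgTensor k H V W) := inferInstanceAs (Module k (V ⊗[k] W))

/-- The action of `H` on `V ⊗ W` through the comultiplication. -/
def act : H →ₐ[k] Module.End k (V ⊗[k] W) :=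
  (Module.endTensorEndAlgHom (R := k) (S := k) (A := k) (M := V) (N := W)).comp
    ((Algebra.TensorProduct.map (Algebra.lsmul k k V) (Algebra.lsmul k k W)).comp
      (Bialgebra.comulAlgHom k H))

instance : Module H (BialgTensor k H V W) := Module.compHom (V ⊗[k] W) (act k H V W).toRingHom

instance : IsScalarTower k H (BialgTensor k H V W) where
  smul_assoc r h v := by
    exact LinearMap.congr_fun (map_smul (act k H V W) r h) v

end BialgTensor

end

/-!
Put `y = x^s`, `V = V_p(σ, α)`, `W = V_t(μ, β)`, `c = μ^s(a)` and `γ = α c + β`. Because `χ⁻¹(a)` is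
a primitive `s`-th root of unity, the `q`-binomial theorem gives `Δ(y) = y ⊗ a^s + 1 ⊗ y`
(`HopfOre.comul_Y`), and `a^s` acts on `W` by the scalar `c`. Hence `y - γ` acts on `V ⊗ W` as
`c (y - α) ⊗ 1 + 1 ⊗ (y - β)` (`HopfOre.Ysub_smul_mk`).

For each `l < s`, the vectors `(y - α)^i m_0 ⊗ (y - β)^j m_l` span a subspace of weight `χ^l σ μ`
which, up to the nonzero scalar `c`, is the tensor product of nilpotent Jordan blocks of sizes `p`
and `t`. In characteristic zero such a product is an `sl₂`-module, and Clebsch–Gordan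
(`clebschGordan`) splits it into strings through vectors `u_{l,d}`, `d < min p t`, of lengths
`p + t - 1 - 2d`; these are the numbers `2j - 1 + |p - t|` for `j = min p t - d`.

By its universal property (`HopfOre.exists_polyMod_hom`), `V_n(ν, γ)` maps to any module with a
vector `w` of weight `ν` such that `(y - γ)^n w = 0`. Sending the generators to the `u_{l,d}` gives
a map from the direct sum to `V ⊗ W`. Its image contains `m_0 ⊗ W`, and `m_0 ⊗ W` generates `V ⊗ W`
because the leading term of `x (m_i ⊗ w)` is `m_{i+1} ⊗ a w` (`HopfOre.eq_top_of_stringVec_mem`).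
The map is therefore onto, and both sides have dimension `p t s²`. No inverse of `y` is needed, so
the case `γ = 0` is covered; there the summands are nilpotent by the same universal property.
-/

/-! ### The `q`-binomial theorem at a root of unity -/

/-- The Gaussian binomial coefficient `[i + m choose i]_q`, indexed by the two complementary
lengths and defined by the `q`-Pascal recursion. -/
def gaussBinom {k : Type*} [CommRing k] (q : k) : ℕ → ℕ → k
  | 0, _ => 1
  | _ + 1, 0 => 1
  | i + 1, m + 1 => gaussBinom q i (m + 1) + q ^ (i + 1) * gaussBinom q (i + 1) m

theorem gaussBinom_zero_right {k : Type*} [CommRing k] (q : k) (i : ℕ) :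
    gaussBinom q i 0 = 1 := by
  cases i <;> simp [gaussBinom]

/-- The closed formula `[i + m choose i]_q (q)_i (q)_m = (q)_{i+m}` in terms of `q`-Pochhammer
symbols `(q)_n = ∏_{j<n} (1 - q^{j+1})`. -/
theorem gaussBinom_mul_prod {k : Type*} [CommRing k] (q : k) (i m : ℕ) :
    gaussBinom q i m * (∏ j ∈ Finset.range i, (1 - q ^ (j + 1))) *
      (∏ j ∈ Finset.range m, (1 - q ^ (j + 1))) =
      ∏ j ∈ Finset.range (i + m), (1 - q ^ (j + 1)) := by
  induction i generalizing m with
  | zero => simp [gaussBinom]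
  | succ i ihi =>
    induction m with
    | zero => simp [gaussBinom]
    | succ m ihm =>
      have h1 := ihi (m + 1)
      rw [gaussBinom]
      rw [Finset.prod_range_succ _ i] at ihm ⊢
      rw [Finset.prod_range_succ _ m] at h1 ⊢
      rw [show i + 1 + (m + 1) = (i + (m + 1)) + 1 by ring, Finset.prod_range_succ]
      rw [show i + 1 + m = i + (m + 1) by ring] at ihm
      rw [show q ^ (i + (m + 1) + 1) = q ^ (i + 1) * q ^ (m + 1) by ring]
      linear_combination (1 - q ^ (i + 1)) * h1 + q ^ (i + 1) * (1 - q ^ (m + 1)) * ihm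

theorem gaussBinom_eq_zero {k : Type*} [Field k] {q : k} {s i m : ℕ} (hq : IsPrimitiveRoot q s)
    (hi : 0 < i) (hm : 0 < m) (h : i + m = s) : gaussBinom q i m = 0 := by
  have key := gaussBinom_mul_prod q i m
  have hne : ∀ n < s, ∏ j ∈ Finset.range n, (1 - q ^ (j + 1)) ≠ 0 := fun n hn =>
    Finset.prod_ne_zero_iff.mpr fun j hj h0 =>
      hq.pow_ne_one_of_pos_of_lt (Nat.succ_ne_zero j) (by have := Finset.mem_range.mp hj; omega)
        (sub_eq_zero.mp h0).symm
  have h0 : ∏ j ∈ Finset.range (i + m), (1 - q ^ (j + 1)) = 0 := by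
    refine Finset.prod_eq_zero (i := s - 1) (Finset.mem_range.mpr (by omega)) ?_
    rw [show s - 1 + 1 = s by omega, hq.pow_eq_one, sub_self]
  rw [h0] at key
  rcases mul_eq_zero.mp key with h1 | h1
  · exact (mul_eq_zero.mp h1).resolve_right (hne i (by omega))
  · exact absurd h1 (hne m (by omega))

/-- The `q`-binomial theorem for elements satisfying `B A = q A B`. -/
theorem add_pow_of_qCommute {k R : Type*} [CommRing k] [Ring R] [Algebra k R] {q : k} {A B : R}
    (h : B * A = q • (A * B)) (n : ℕ) :
    (A + B) ^ n = ∑ x ∈ Finset.HasAntidiagonal.antidiagonal n,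
      gaussBinom q x.1 x.2 • (A ^ x.1 * B ^ x.2) := by
  have hpow : ∀ i : ℕ, B * A ^ i = q ^ i • (A ^ i * B) := by
    intro i
    induction i with
    | zero => simp
    | succ i ih =>
      rw [pow_succ, ← mul_assoc, ih, smul_mul_assoc, mul_assoc, h, mul_smul_comm, smul_smul,
        pow_succ, mul_assoc]
  induction n with
  | zero => simp [gaussBinom]
  | succ n ih =>
    -- The recursion splits the coefficient into the parts coming from `A * _` and from `B * _`.
    have hsplit : ∀ x ∈ Finset.HasAntidiagonal.antidiagonal (n + 1),
        gaussBinom q x.1 x.2 • (A ^ x.1 * B ^ x.2) =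
          (if x.1 = 0 then 0 else gaussBinom q (x.1 - 1) x.2) • (A ^ x.1 * B ^ x.2) +
          (if x.2 = 0 then 0 else q ^ x.1 * gaussBinom q x.1 (x.2 - 1)) •
            (A ^ x.1 * B ^ x.2) := by
      rintro ⟨i, m⟩ hx
      rw [Finset.HasAntidiagonal.mem_antidiagonal] at hx
      rw [← add_smul]
      congr 1
      rcases i with - | i <;> rcases m with - | m
      · simp at hx
      · simp [gaussBinom]
      · simp [gaussBinom_zero_right]
      · simp [gaussBinom]
    rw [Finset.sum_congr rfl hsplit, Finset.sum_add_distrib,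
      Finset.Nat.sum_antidiagonal_succ, Finset.Nat.sum_antidiagonal_succ', pow_succ', ih, add_mul,
      Finset.mul_sum, Finset.mul_sum]
    simp only [if_true, zero_smul, zero_add, Nat.succ_ne_zero, if_false, Nat.add_sub_cancel]
    congr 1
    · refine Finset.sum_congr rfl fun x _ => ?_
      rw [mul_smul_comm, pow_succ', mul_assoc]
    · refine Finset.sum_congr rfl fun x _ => ?_
      rw [mul_smul_comm, ← mul_assoc, hpow, smul_mul_assoc, smul_smul, pow_succ', mul_assoc,
        mul_comm (q ^ _)]

/-- At a primitive `s`-th root of unity all mixed terms of the `q`-binomial theorem vanish. -/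
theorem add_pow_of_qCommute_of_isPrimitiveRoot {k R : Type*} [Field k] [Ring R] [Algebra k R]
    {q : k} {A B : R} {s : ℕ} (h : B * A = q • (A * B)) (hq : IsPrimitiveRoot q s) (hs : 0 < s) :
    (A + B) ^ s = A ^ s + B ^ s := by
  obtain ⟨s, rfl⟩ : ∃ r, s = r + 1 := ⟨s - 1, by omega⟩
  rw [add_pow_of_qCommute h, Finset.Nat.sum_antidiagonal_succ]
  rw [Finset.sum_eq_single (s, 0)]
  · simp [gaussBinom, add_comm]
  · rintro ⟨i, m⟩ hx hne
    rw [Finset.HasAntidiagonal.mem_antidiagonal] at hx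
    have hm : m ≠ 0 := by
      rintro rfl
      exact hne (by simpa using hx)
    rw [gaussBinom_eq_zero hq (Nat.succ_pos i) (Nat.pos_of_ne_zero hm) (by simp at hx; omega),
      zero_smul]
  · intro hx
    simp at hx

/-! ### The Clebsch–Gordan rule for nilpotent Jordan blocks -/

/-- The indicator function of the point `(i, j)` of the grid `Fin p × Fin t`, for arbitrary natural
numbers `i` and `j`: it is `0` when `(i, j)` lies outside the grid. -/
def gridVec (k : Type*) [Field k] (p t i j : ℕ) : Fin p × Fin t → k :=
  fun x => if (x.1 : ℕ) = i ∧ (x.2 : ℕ) = j then 1 else 0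

theorem gridVec_eq_zero {k : Type*} [Field k] {p t i j : ℕ} (h : p ≤ i ∨ t ≤ j) :
    gridVec k p t i j = 0 := by
  ext x
  have := x.1.2
  have := x.2.2
  simp only [gridVec, Pi.zero_apply, ite_eq_right_iff]
  omega

/-- The linear map on functions on the grid that sends the indicator of `(i, j)` to `g i j`. -/
noncomputable def gridMap {k : Type*} [Field k] {M : Type*} [AddCommGroup M] [Module k M] (p t : ℕ)
    (g : ℕ → ℕ → M) : (Fin p × Fin t → k) →ₗ[k] M :=
  (Pi.basisFun k (Fin p × Fin t)).constr k fun x => g x.1 x.2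

theorem gridVec_fin {k : Type*} [Field k] {p t : ℕ} (x : Fin p × Fin t) :
    gridVec k p t x.1 x.2 = Pi.basisFun k (Fin p × Fin t) x := by
  ext y
  rw [Pi.basisFun_apply, Pi.single_apply]
  simp only [gridVec, Prod.ext_iff, Fin.ext_iff]

theorem gridMap_gridVec {k : Type*} [Field k] {M : Type*} [AddCommGroup M] [Module k M] {p t : ℕ}
    {g : ℕ → ℕ → M} (hg : ∀ i j, p ≤ i ∨ t ≤ j → g i j = 0) (i j : ℕ) :
    gridMap (k := k) p t g (gridVec k p t i j) = g i j := by
  by_cases h : p ≤ i ∨ t ≤ j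
  · rw [hg i j h, gridVec_eq_zero h, map_zero]
  · push Not at h
    have := gridVec_fin (k := k) ((⟨i, h.1⟩, ⟨j, h.2⟩) : Fin p × Fin t)
    simp only at this
    rw [this, gridMap, Module.Basis.constr_basis]

theorem grid_hom_ext {k : Type*} [Field k] {M : Type*} [AddCommGroup M] [Module k M] {p t : ℕ}
    {f g : (Fin p × Fin t → k) →ₗ[k] M}
    (h : ∀ i j, f (gridVec k p t i j) = g (gridVec k p t i j)) : f = g :=
  (Pi.basisFun k (Fin p × Fin t)).ext fun x => by rw [← gridVec_fin]; exact h _ _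

section sl2

attribute [local instance] LieRing.ofAssociativeRing

variable (k : Type*) [Field k] (p t : ℕ)

/-- The lowering operator on the tensor product of the irreducible `sl₂`-modules of dimensions
`p` and `t`, realised on functions on the grid: a step to the right plus a step upwards. -/
noncomputable def gridF : Module.End k (Fin p × Fin t → k) :=
  gridMap p t fun i j => gridVec k p t (i + 1) j + gridVec k p t i (j + 1)

/-- The raising operator of the `sl₂`-action on functions on the grid. The coefficients vanish where
the subtractions `i - 1` and `j - 1` are truncated. -/
noncomputable def gridE : Module.End k (Fin p × Fin t → k) :=
  gridMap p t fun i j => ((i : k) * (p - i)) • gridVec k p t (i - 1) j +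
    ((j : k) * (t - j)) • gridVec k p t i (j - 1)

/-- The weight operator of the `sl₂`-action on functions on the grid. -/
noncomputable def gridH : Module.End k (Fin p × Fin t → k) :=
  gridMap p t fun i j => ((p : k) + t - 2 - 2 * (i + j)) • gridVec k p t i j

variable {k p t}

theorem gridF_gridVec (i j : ℕ) : gridF k p t (gridVec k p t i j) =
    gridVec k p t (i + 1) j + gridVec k p t i (j + 1) :=
  gridMap_gridVec (fun i j h => by
    rw [gridVec_eq_zero (by omega), gridVec_eq_zero (by omega), add_zero]) i j

theorem gridE_gridVec (i j : ℕ) : gridE k p t (gridVec k p t i j) =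
    ((i : k) * (p - i)) • gridVec k p t (i - 1) j +
      ((j : k) * (t - j)) • gridVec k p t i (j - 1) := by
  refine gridMap_gridVec (g := fun i j : ℕ => ((i : k) * (p - i)) • gridVec k p t (i - 1) j +
      ((j : k) * (t - j)) • gridVec k p t i (j - 1)) (fun i j h => ?_) i j
  have h1 : ((i : k) * (p - i)) • gridVec k p t (i - 1) j = 0 := by
    by_cases hi : i = p
    · simp [hi]
    · rw [gridVec_eq_zero (by omega), smul_zero]
  have h2 : ((j : k) * (t - j)) • gridVec k p t i (j - 1) = 0 := by
    by_cases hj : j = t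
    · simp [hj]
    · rw [gridVec_eq_zero (by omega), smul_zero]
  rw [h1, h2, add_zero]

theorem gridH_gridVec (i j : ℕ) : gridH k p t (gridVec k p t i j) =
    ((p : k) + t - 2 - 2 * (i + j)) • gridVec k p t i j :=
  gridMap_gridVec (g := fun i j : ℕ => ((p : k) + t - 2 - 2 * (i + j)) • gridVec k p t i j)
    (fun i j h => by rw [gridVec_eq_zero h, smul_zero]) i j

theorem isSl2Triple_grid [CharZero k] (hp : 1 ≤ p) (ht : 1 ≤ t) (hpt : p + t ≠ 2) :
    IsSl2Triple (gridH k p t) (gridE k p t) (gridF k p t) where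
  h_ne_zero := fun h => by
    have h0 := congrFun (LinearMap.congr_fun h (gridVec k p t 0 0)) (⟨0, hp⟩, ⟨0, ht⟩)
    rw [gridH_gridVec] at h0
    simp only [gridVec, Pi.smul_apply, and_self, if_true, LinearMap.zero_apply, Pi.zero_apply,
      smul_eq_mul, mul_one, Nat.cast_zero, add_zero, mul_zero, sub_zero] at h0
    exact hpt (by exact_mod_cast sub_eq_zero.mp h0)
  lie_e_f := grid_hom_ext fun i j => by
    rw [Ring.lie_def, LinearMap.sub_apply, Module.End.mul_apply, Module.End.mul_apply,
      gridF_gridVec, gridE_gridVec, map_add, map_add, map_smul, map_smul]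
    simp only [gridF_gridVec, gridE_gridVec, gridH_gridVec]
    rcases i with - | i <;> rcases j with - | j <;>
      simp only [Nat.add_sub_cancel, Nat.cast_add, Nat.cast_one, Nat.cast_zero, zero_mul,
        zero_smul] <;> module
  lie_h_e_nsmul := grid_hom_ext fun i j => by
    rw [Ring.lie_def, LinearMap.sub_apply, Module.End.mul_apply, Module.End.mul_apply,
      gridH_gridVec, LinearMap.smul_apply, map_smul]
    simp only [gridE_gridVec, map_add, map_smul, gridH_gridVec]
    rcases i with - | i <;> rcases j with - | j <;>
      simp only [Nat.add_sub_cancel, Nat.cast_add, Nat.cast_one, Nat.cast_zero, zero_mul,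
        zero_smul] <;> module
  lie_h_f_nsmul := grid_hom_ext fun i j => by
    rw [Ring.lie_def, LinearMap.sub_apply, Module.End.mul_apply, Module.End.mul_apply,
      gridH_gridVec, LinearMap.neg_apply, LinearMap.smul_apply, map_smul]
    simp only [gridF_gridVec, map_add, gridH_gridVec]
    simp only [Nat.cast_add, Nat.cast_one]
    module

variable (k) in
/-- The weights `∏_{l<i} 1 / ((l + 1)(p - 1 - l))`, which turn the raising operator of the
`p`-dimensional irreducible `sl₂`-module into a plain shift. -/
noncomputable def primCoeff (p i : ℕ) : k := ∏ l ∈ Finset.range i, (((l : k) + 1) * (p - 1 - l))⁻¹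

theorem primCoeff_factor_ne_zero [CharZero k] {l : ℕ} (h : l + 1 < p) :
    ((l : k) + 1) * (p - 1 - l) ≠ 0 := by
  obtain ⟨r, rfl⟩ : ∃ r, p = l + 2 + r := ⟨p - (l + 2), by omega⟩
  refine mul_ne_zero (by exact_mod_cast Nat.succ_ne_zero l) ?_
  rw [show ((l + 2 + r : ℕ) : k) - 1 - l = ((r + 1 : ℕ) : k) by push_cast; ring]
  exact_mod_cast Nat.succ_ne_zero r

theorem primCoeff_ne_zero [CharZero k] {i : ℕ} (h : i < p) : primCoeff k p i ≠ 0 :=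
  Finset.prod_ne_zero_iff.mpr fun l hl =>
    inv_ne_zero (primCoeff_factor_ne_zero (by have := Finset.mem_range.mp hl; omega))

theorem primCoeff_succ [CharZero k] {i : ℕ} (h : i + 1 < p) :
    primCoeff k p (i + 1) * (((i : k) + 1) * (p - 1 - i)) = primCoeff k p i := by
  rw [primCoeff, Finset.prod_range_succ, mul_assoc,
    inv_mul_cancel₀ (primCoeff_factor_ne_zero h), mul_one, primCoeff]

variable (k p t) in
/-- The primitive vector of degree `d`, that is, of weight `p + t - 2 - 2d`. -/
noncomputable def primVec (d : ℕ) : Fin p × Fin t → k :=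
  ∑ x ∈ Finset.HasAntidiagonal.antidiagonal d,
    ((-1) ^ x.1 * primCoeff k p x.1 * primCoeff k t x.2) • gridVec k p t x.1 x.2

theorem primVec_ne_zero [CharZero k] {d : ℕ} (hp : d < p) (ht : d < t) :
    primVec k p t d ≠ 0 := by
  intro h
  have h0 := congrFun h (⟨0, by omega⟩, ⟨d, ht⟩)
  rw [primVec, Finset.sum_apply, Finset.sum_eq_single (0, d)] at h0
  · have h1 : primCoeff k p 0 = 1 := rfl
    simp only [gridVec, Pi.smul_apply, and_self, if_true, pow_zero, h1, one_mul, smul_eq_mul,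
      mul_one, Pi.zero_apply] at h0
    exact primCoeff_ne_zero ht h0
  · rintro ⟨i, j⟩ hx hne
    have : ¬ (0 = i ∧ d = j) := fun h => hne (by rw [← h.1, ← h.2])
    simp [gridVec, this]
  · simp

theorem gridH_primVec (d : ℕ) :
    gridH k p t (primVec k p t d) = ((p : k) + t - 2 - 2 * d) • primVec k p t d := by
  rw [primVec, map_sum, Finset.smul_sum]
  refine Finset.sum_congr rfl fun x hx => ?_
  rw [map_smul, gridH_gridVec, ← Finset.HasAntidiagonal.mem_antidiagonal.mp hx, smul_comm]
  push_cast
  rfl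

theorem gridE_primVec [CharZero k] {d : ℕ} (hp : d < p) (ht : d < t) :
    gridE k p t (primVec k p t d) = 0 := by
  rw [primVec, map_sum]
  simp only [map_smul, gridE_gridVec, smul_add, Finset.sum_add_distrib]
  rcases d with - | d
  · simp
  · rw [Finset.Nat.sum_antidiagonal_succ, Finset.Nat.sum_antidiagonal_succ']
    simp only [Nat.cast_zero, zero_mul, zero_smul, smul_zero, zero_add, Nat.add_sub_cancel]
    rw [← Finset.sum_add_distrib]
    refine Finset.sum_eq_zero fun x hx => ?_
    have hx := Finset.HasAntidiagonal.mem_antidiagonal.mp hx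
    have h1 := primCoeff_succ (k := k) (p := p) (i := x.1) (by omega)
    have h2 := primCoeff_succ (k := k) (p := t) (i := x.2) (by omega)
    rw [smul_smul, smul_smul, ← add_smul]
    convert zero_smul k _
    push_cast
    linear_combination (-1) ^ (x.1 + 1) * primCoeff k t x.2 * h1 +
      (-1) ^ x.1 * primCoeff k p x.1 * h2

theorem sum_clebschGordan_dims (p t : ℕ) :
    ∑ d : Fin (min p t), (p + t - 1 - 2 * (d : ℕ)) = p * t := by
  rw [Fin.sum_univ_eq_sum_range (fun d => p + t - 1 - 2 * d) (min p t)]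
  wlog h : p ≤ t generalizing p t
  · rw [min_comm, add_comm, mul_comm]
    exact this t p (by omega)
  rw [min_eq_left h]
  obtain ⟨e, rfl⟩ := Nat.exists_eq_add_of_le h
  have : ∀ m ≤ p, ∑ d ∈ Finset.range m, (p + (p + e) - 1 - 2 * d) = m * (p + (p + e) - m) := by
    intro m hm
    induction m with
    | zero => simp
    | succ m ih =>
      rw [Finset.sum_range_succ, ih (by omega)]
      obtain ⟨r, rfl⟩ := Nat.exists_eq_add_of_le hm
      rw [show m + 1 + r + (m + 1 + r + e) - m = m + 2 * r + 2 + e by omega,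
        show m + 1 + r + (m + 1 + r + e) - (m + 1) = m + 1 + 2 * r + e by omega,
        show m + 1 + r + (m + 1 + r + e) - 1 - 2 * m = 2 * r + 1 + e by omega]
      ring
  rw [this p le_rfl, show p + (p + e) - p = p + e by omega]

open LieModule in
/-- Clebsch–Gordan on the grid: the strings `F^m u_d`, `m < p + t - 1 - 2d`, through the
primitive vectors `u_d` span. -/
theorem grid_clebschGordan [CharZero k] (hp : 1 ≤ p) (ht : 1 ≤ t) :
    (∀ d < min p t, (gridF k p t ^ (p + t - 1 - 2 * d)) (primVec k p t d) = 0) ∧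
    Submodule.span k {v | ∃ d m, d < min p t ∧ v = (gridF k p t ^ m) (primVec k p t d)} = ⊤ := by
  by_cases hpt : p + t = 2
  · -- Here the weight operator is zero, which `IsSl2Triple` excludes.
    obtain ⟨rfl, rfl⟩ : p = 1 ∧ t = 1 := by omega
    have hu : primVec k 1 1 0 = gridVec k 1 1 0 0 := by simp [primVec, primCoeff]
    constructor
    · intro d hd
      obtain rfl : d = 0 := by omega
      simp [hu, gridF_gridVec, gridVec_eq_zero]
    · rw [eq_top_iff, ← (Pi.basisFun k (Fin 1 × Fin 1)).span_eq, Submodule.span_le]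
      rintro _ ⟨x, rfl⟩
      refine Submodule.subset_span ⟨0, 0, by simp, ?_⟩
      rw [← gridVec_fin, hu]
      simp
  have T := isSl2Triple_grid (k := k) hp ht hpt
  have hN : ∀ d < min p t, ((p : k) + t - 2 - 2 * d) = ((p + t - 2 - 2 * d : ℕ) : k) := by
    intro d hd
    rw [Nat.cast_sub (by omega), Nat.cast_sub (by omega)]
    push_cast
    ring
  have P : ∀ d < min p t,
      T.HasPrimitiveVectorWith (primVec k p t d) ((p + t - 2 - 2 * d : ℕ) : k) := fun d hd =>
    { ne_zero := primVec_ne_zero (by omega) (by omega)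
      lie_h := by rw [← hN d hd]; exact gridH_primVec d
      lie_e := gridE_primVec (by omega) (by omega) }
  have hzero : ∀ d < min p t, (gridF k p t ^ (p + t - 1 - 2 * d)) (primVec k p t d) = 0 := by
    intro d hd
    have := (P d hd).pow_toEnd_f_eq_zero_of_eq_nat rfl
    rwa [show p + t - 2 - 2 * d + 1 = p + t - 1 - 2 * d by omega] at this
  refine ⟨hzero, ?_⟩
  -- `K` is the shifted Casimir operator `4FE + H² + 2H + 1` plus `N H`. On the `m`-th vector of the
  -- string of highest weight `w` its eigenvalue is `(w + 1)² + N (w - 2m)`, and `N` is so large that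
  -- these integers tell all the pairs `(w, m)` apart.
  let N : ℤ := (p + t) ^ 2
  let K : Module.End k (Fin p × Fin t → k) :=
    (4 : k) • (gridF k p t * gridE k p t) + gridH k p t * gridH k p t +
      (2 + N : k) • gridH k p t + 1
  let ι := Σ d : Fin (min p t), Fin (p + t - 1 - 2 * (d : ℕ))
  let wt : ι → ℤ := fun x => (p : ℤ) + t - 2 - 2 * (x.1 : ℕ)
  let ev : ι → ℤ := fun x => (wt x + 1) ^ 2 + N * (wt x - 2 * (x.2 : ℕ))
  let v : ι → (Fin p × Fin t → k) := fun x => (gridF k p t ^ (x.2 : ℕ)) (primVec k p t x.1)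
  have hev : Function.Injective fun x => (ev x : k) := by
    rintro ⟨d, m⟩ ⟨d', m'⟩ h
    have h : ev ⟨d, m⟩ = ev ⟨d', m'⟩ := Int.cast_injective (α := k) h
    have hd := d.2
    have hd' := d'.2
    have hN0 : 0 < N := by positivity
    have hb : ∀ x : ι, 0 ≤ (wt x + 1) ^ 2 ∧ (wt x + 1) ^ 2 < N ∧ 0 < wt x + 1 := by
      intro x
      have hx := x.1.2
      have h1 : 0 < wt x + 1 := by simp only [wt]; omega
      have h2 : wt x + 1 < (p : ℤ) + t := by simp only [wt]; omega
      exact ⟨sq_nonneg _, by simp only [N]; nlinarith, h1⟩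
    have hmod : (wt ⟨d, m⟩ + 1) ^ 2 = (wt ⟨d', m'⟩ + 1) ^ 2 := by
      have e := congrArg (· % N) h
      simp only [ev, Int.add_mul_emod_self_left] at e
      rwa [Int.emod_eq_of_lt (hb _).1 (hb _).2.1, Int.emod_eq_of_lt (hb _).1 (hb _).2.1] at e
    have hw : wt ⟨d, m⟩ = wt ⟨d', m'⟩ := by
      have := (sq_eq_sq₀ (hb ⟨d, m⟩).2.2.le (hb ⟨d', m'⟩).2.2.le).mp hmod
      omega
    have hm : wt ⟨d, m⟩ - 2 * (m : ℕ) = wt ⟨d', m'⟩ - 2 * (m' : ℕ) := by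
      have e : N * (wt ⟨d, m⟩ - 2 * (m : ℕ)) = N * (wt ⟨d', m'⟩ - 2 * (m' : ℕ)) := by
        simp only [ev] at h
        linarith
      exact mul_left_cancel₀ hN0.ne' e
    obtain rfl : d = d' := Fin.ext (by simp only [wt] at hw; omega)
    obtain rfl : m = m' := Fin.ext (by omega)
    rfl
  have hvec : ∀ x, K.HasEigenvector (ev x : k) (v x) := by
    rintro ⟨d, m⟩
    have Pd := P d d.2
    have hm : (m : ℕ) < p + t - 1 - 2 * (d : ℕ) := m.2
    have hle : (m : ℕ) ≤ p + t - 2 - 2 * (d : ℕ) := by omega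
    have hne : v ⟨d, m⟩ ≠ 0 := Pd.pow_toEnd_f_ne_zero_of_eq_nat rfl hle
    have hH : gridH k p t (v ⟨d, m⟩) =
        (((p + t - 2 - 2 * (d : ℕ) : ℕ) : k) - 2 * (m : ℕ)) • v ⟨d, m⟩ :=
      Pd.lie_h_pow_toEnd_f m
    have hFE : gridF k p t (gridE k p t (v ⟨d, m⟩)) =
        (((m : ℕ) : k) * (((p + t - 2 - 2 * (d : ℕ) : ℕ) : k) - ((m : ℕ) - 1))) • v ⟨d, m⟩ := by
      obtain ⟨m, hm'⟩ := m
      rcases m with - | m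
      · simp [v, gridE_primVec (k := k) (p := p) (t := t) (d := d) (by omega) (by omega)]
      · have := Pd.lie_e_pow_succ_toEnd_f m
        have h2 : gridE k p t (v ⟨d, m + 1, hm'⟩) = (((m : k) + 1) *
          (((p + t - 2 - 2 * (d : ℕ) : ℕ) : k) - m)) • (gridF k p t ^ m) (primVec k p t d) := this
        rw [h2, map_smul]
        simp only [v, pow_succ', Module.End.mul_apply]
        push_cast
        congr 2
        ring
    rw [Module.End.hasEigenvector_iff]
    refine ⟨Module.End.mem_eigenspace_iff.mpr ?_, hne⟩
    simp only [K, LinearMap.add_apply, LinearMap.smul_apply, Module.End.mul_apply,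
      Module.End.one_apply, hFE, hH, map_smul, ev, wt]
    rw [← hN d d.2]
    push_cast
    module
  have hli := Module.End.eigenvectors_linearIndependent' K _ hev v hvec
  have hcard : Fintype.card ι = Module.finrank k (Fin p × Fin t → k) := by
    rw [Module.finrank_pi, Fintype.card_prod, Fintype.card_fin, Fintype.card_fin,
      ← sum_clebschGordan_dims p t, Fintype.card_sigma]
    simp only [Fintype.card_fin]
  rw [eq_top_iff, ← hli.span_eq_top_of_card_eq_finrank' hcard]
  refine Submodule.span_mono ?_
  rintro _ ⟨x, rfl⟩
  exact ⟨x.1, x.2, x.1.2, rfl⟩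

end sl2

/-- Clebsch–Gordan for a family `e i j` of vectors on which an endomorphism `F` acts as the sum of
the two shifts, and which vanishes outside the grid `i < p`, `j < t`. -/
theorem clebschGordan {k : Type*} [Field k] [CharZero k] {M : Type*} [AddCommGroup M] [Module k M]
    {p t : ℕ} (hp : 1 ≤ p) (ht : 1 ≤ t) (F : Module.End k M) (e : ℕ → ℕ → M)
    (he : ∀ i j, p ≤ i ∨ t ≤ j → e i j = 0) (hF : ∀ i j, F (e i j) = e (i + 1) j + e i (j + 1)) :
    ∃ u : ℕ → M,
      (∀ d < min p t, u d ∈ Submodule.span k {v | ∃ i j, v = e i j} ∧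
        (F ^ (p + t - 1 - 2 * d)) (u d) = 0) ∧
      ∀ i j, e i j ∈ Submodule.span k {v | ∃ d m, d < min p t ∧ v = (F ^ m) (u d)} := by
  obtain ⟨h1, h2⟩ := grid_clebschGordan (k := k) hp ht
  let φ : (Fin p × Fin t → k) →ₗ[k] M := gridMap p t e
  have hφ : ∀ i j, φ (gridVec k p t i j) = e i j := gridMap_gridVec he
  have hc : φ ∘ₗ gridF k p t = F ∘ₗ φ := grid_hom_ext fun i j => by
    simp only [LinearMap.comp_apply, gridF_gridVec, map_add, hφ, hF]
  have hpow : ∀ m v, φ ((gridF k p t ^ m) v) = (F ^ m) (φ v) := by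
    intro m v
    induction m with
    | zero => rfl
    | succ m ih =>
      rw [pow_succ', pow_succ', Module.End.mul_apply, Module.End.mul_apply, ← ih]
      exact LinearMap.congr_fun hc _
  refine ⟨fun d => φ (primVec k p t d), fun d hd => ⟨?_, ?_⟩, fun i j => ?_⟩
  · simp only [primVec, map_sum]
    refine Submodule.sum_mem _ fun x _ => ?_
    rw [map_smul, hφ]
    exact Submodule.smul_mem _ _ (Submodule.subset_span ⟨_, _, rfl⟩)
  · rw [← hpow, h1 d hd, map_zero]
  · have : gridVec k p t i j ∈ (⊤ : Submodule k (Fin p × Fin t → k)) := trivial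
    rw [← h2] at this
    have := Submodule.mem_map_of_mem (f := φ) this
    rw [Submodule.map_span, hφ] at this
    refine Submodule.span_mono ?_ this
    rintro _ ⟨_, ⟨d, m, hd, rfl⟩, rfl⟩
    exact ⟨d, m, hd, hpow _ _⟩

/-! ### The universal property of the modules `V(ν, f)` -/

namespace HopfOre

section Modules

variable {k G : Type*} [Field k] [Group G] {χ : G →* kˣ} {a : Subgroup.center G}

/-- A `k`-linear map between `H`-modules that commutes with the generators of `H` is
`H`-linear. -/
def linearMapOfGenerators {M M' : Type*} [AddCommGroup M] [Module k M] [Module (HopfOre χ a) M]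
    [IsScalarTower k (HopfOre χ a) M] [AddCommGroup M'] [Module k M'] [Module (HopfOre χ a) M']
    [IsScalarTower k (HopfOre χ a) M'] (φ : M →ₗ[k] M')
    (hg : ∀ g v, φ (of χ a g • v) = of χ a g • φ v)
    (hx : ∀ v, φ (X χ a • v) = X χ a • φ v) : M →ₗ[HopfOre χ a] M' where
  toFun := φ
  map_add' := map_add φ
  map_smul' h v := by
    simp only [RingHom.id_apply]
    induction h using induction_on generalizing v with
    | hr r => rw [algebraMap_smul, algebraMap_smul, map_smul]
    | hg g => exact hg g v
    | hx => exact hx v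
    | hmul u w hu hw => rw [mul_smul, hu, hw, mul_smul]
    | hadd u w hu hw => rw [add_smul, map_add, hu, hw, add_smul]

section Single

variable {N : ℕ}

theorem xAct_pow_single_zero (w : Fin N → k) (i : ℕ) (h : i < N) :
    (xAct N w ^ i) (Pi.single ⟨0, by omega⟩ 1) = Pi.single ⟨i, h⟩ 1 := by
  induction i with
  | zero => rfl
  | succ i ih =>
    rw [pow_succ', Module.End.mul_apply, ih (by omega), xAct_single, dif_pos h]

theorem xAct_pow_single_zero_top (w : Fin N → k) (h : 0 < N) :
    (xAct N w ^ N) (Pi.single ⟨0, h⟩ 1) = w := by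
  obtain ⟨n, rfl⟩ : ∃ n, N = n + 1 := ⟨N - 1, by omega⟩
  rw [pow_succ', Module.End.mul_apply, xAct_pow_single_zero w n (by omega), xAct_single,
    dif_neg (by simp)]

theorem cyclicAct_of (ν : G →* kˣ) (w : Fin N → k) (hw : ∀ i, w i ≠ 0 → χ ^ (i : ℕ) = χ ^ N)
    (g : G) : cyclicAct χ a ν N w hw (of χ a g) = grpAct χ ν N g := by
  rw [cyclicAct, lift_of]

theorem cyclicAct_X_pow (ν : G →* kˣ) (w : Fin N → k)
    (hw : ∀ i, w i ≠ 0 → χ ^ (i : ℕ) = χ ^ N) (i : ℕ) :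
    cyclicAct χ a ν N w hw (X χ a ^ i) = xAct N w ^ i := by
  rw [map_pow, cyclicAct, lift_X]

theorem cyclicAct_of_single_zero (ν : G →* kˣ) (w : Fin N → k)
    (hw : ∀ i, w i ≠ 0 → χ ^ (i : ℕ) = χ ^ N) (h : 0 < N) (g : G) :
    cyclicAct χ a ν N w hw (of χ a g) (Pi.single ⟨0, h⟩ 1) =
      ((ν g : kˣ) : k) • Pi.single ⟨0, h⟩ (1 : k) := by
  rw [cyclicAct_of, grpAct_single, MonoidHom.mul_apply, MonoidHom.pow_apply]
  simp only [pow_zero, one_mul]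

theorem cyclicAct_X_pow_single_zero (ν : G →* kˣ) (w : Fin N → k)
    (hw : ∀ i, w i ≠ 0 → χ ^ (i : ℕ) = χ ^ N) (i : Fin N) :
    cyclicAct χ a ν N w hw (X χ a ^ (i : ℕ)) (Pi.single ⟨0, i.pos⟩ 1) = Pi.single i 1 := by
  rw [cyclicAct_X_pow]
  exact xAct_pow_single_zero w i i.2

theorem cyclicAct_X_pow_single_zero_top (ν : G →* kˣ) (w : Fin N → k)
    (hw : ∀ i, w i ≠ 0 → χ ^ (i : ℕ) = χ ^ N) (h : 0 < N) :
    cyclicAct χ a ν N w hw (X χ a ^ N) (Pi.single ⟨0, h⟩ 1) = w := by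
  rw [cyclicAct_X_pow, xAct_pow_single_zero_top]

end Single

theorem X_pow_mul_of (i : ℕ) (g : G) :
    X χ a ^ i * of χ a g = (((χ⁻¹ g : kˣ) : k) ^ i) • (of χ a g * X χ a ^ i) := by
  induction i with
  | zero => simp
  | succ i ih =>
    rw [pow_succ', mul_assoc, ih, mul_smul_comm, ← mul_assoc, X_mul_of, smul_mul_assoc, smul_smul,
      mul_assoc, pow_succ]

section Weight

variable {M : Type*} [AddCommGroup M] [Module k M] [Module (HopfOre χ a) M]
  [IsScalarTower k (HopfOre χ a) M]

/-- Elements of `H` act `k`-linearly. -/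
theorem smul_smul_comm (h : HopfOre χ a) (c : k) (v : M) : h • c • v = c • h • v := by
  rw [← algebraMap_smul (HopfOre χ a) c v, ← algebraMap_smul (HopfOre χ a) c (h • v), smul_smul,
    smul_smul, Algebra.commutes]

theorem map_smul_of_basis {M' : Type*} [AddCommGroup M'] [Module k M'] [Module (HopfOre χ a) M']
    [IsScalarTower k (HopfOre χ a) M'] {ι : Type*} (b : Module.Basis ι k M) (φ : M →ₗ[k] M')
    (h : HopfOre χ a) (hb : ∀ i, φ (h • b i) = h • φ (b i)) (v : M) : φ (h • v) = h • φ v :=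
  LinearMap.congr_fun (b.ext hb :
    φ ∘ₗ Algebra.lsmul k k M h = Algebra.lsmul k k M' h ∘ₗ φ) v

/-- `x` raises weights by `χ`. -/
theorem of_smul_X_pow_smul {ν : G →* kˣ} {w : M}
    (hw : ∀ g, of χ a g • w = ((ν g : kˣ) : k) • w) (i : ℕ) (g : G) :
    of χ a g • X χ a ^ i • w = (((χ ^ i * ν) g : kˣ) : k) • X χ a ^ i • w := by
  have h : X χ a ^ i • of χ a g • w =
      ((χ⁻¹ g : kˣ) : k) ^ i • (of χ a g • X χ a ^ i • w) := by
    rw [← mul_smul, X_pow_mul_of, smul_assoc, mul_smul]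
  rw [hw, smul_smul_comm] at h
  rw [MonoidHom.mul_apply, Units.val_mul, mul_smul, h, smul_smul]
  rw [MonoidHom.pow_apply, Units.val_pow_eq_pow_val, smul_smul, ← mul_pow, MonoidHom.inv_apply,
    Units.mul_inv, one_pow, one_smul]

end Weight

/-- The central element `x^s` of `H`, for `s` the order of `χ`. -/
noncomputable abbrev Y (χ : G →* kˣ) (a : Subgroup.center G) : HopfOre χ a := X χ a ^ orderOf χ

theorem chi_pow_orderOf (g : G) : χ g ^ orderOf χ = 1 := by
  rw [← MonoidHom.pow_apply, pow_orderOf_eq_one, MonoidHom.one_apply]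

theorem commute_Y_of (g : G) : Commute (Y χ a) (of χ a g) := by
  rw [Commute, SemiconjBy, X_pow_mul_of, ← Units.val_pow_eq_pow_val, MonoidHom.inv_apply, inv_pow,
    chi_pow_orderOf, inv_one, Units.val_one, one_smul]

theorem commute_Y_X : Commute (Y χ a) (X χ a) := (Commute.refl _).pow_left _

/-- The element `x^s - γ` of `H`. -/
noncomputable abbrev Ysub (χ : G →* kˣ) (a : Subgroup.center G) (γ : k) : HopfOre χ a :=
  Y χ a - algebraMap k _ γ

theorem commute_Ysub_of (γ : k) (g : G) : Commute (Ysub χ a γ) (of χ a g) :=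
  (commute_Y_of g).sub_left (Algebra.commute_algebraMap_left _ _)

theorem commute_Ysub_X (γ : k) : Commute (Ysub χ a γ) (X χ a) :=
  commute_Y_X.sub_left (Algebra.commute_algebraMap_left _ _)

section PolyMod

variable {ν : G →* kˣ} {f : Polynomial k}

/-- The generator `m_0` of `V(ν, f)`. -/
noncomputable def polyGen (χ : G →* kˣ) (a : Subgroup.center G) (ν : G →* kˣ) (f : Polynomial k)
    (h : 0 < f.natDegree * orderOf χ) : PolyMod χ a ν f :=
  (Pi.single ⟨0, h⟩ 1 : Fin (f.natDegree * orderOf χ) → k)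

/-- The basis `m_0, m_1, …` of `V(ν, f)`. -/
noncomputable def polyBasis (χ : G →* kˣ) (a : Subgroup.center G) (ν : G →* kˣ) (f : Polynomial k) :
    Module.Basis (Fin (f.natDegree * orderOf χ)) k (PolyMod χ a ν f) :=
  Pi.basisFun k (Fin (f.natDegree * orderOf χ))

theorem polyBasis_eq (h : 0 < f.natDegree * orderOf χ) (i : Fin (f.natDegree * orderOf χ)) :
    polyBasis χ a ν f i = X χ a ^ (i : ℕ) • polyGen χ a ν f h :=
  (Pi.basisFun_apply k _ i).trans (cyclicAct_X_pow_single_zero ν (polyVec χ f) _ i).symm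

theorem X_pow_smul_polyGen (h : 0 < f.natDegree * orderOf χ) :
    X χ a ^ (f.natDegree * orderOf χ) • polyGen χ a ν f h = polyVec χ f :=
  cyclicAct_X_pow_single_zero_top ν (polyVec χ f) _ h

theorem of_smul_polyGen (h : 0 < f.natDegree * orderOf χ) (g : G) :
    of χ a g • polyGen χ a ν f h = ((ν g : kˣ) : k) • polyGen χ a ν f h :=
  cyclicAct_of_single_zero ν (polyVec χ f) _ h g

/-- The sum defining `x · m_{ns-1}`, applied to arbitrary vectors in place of the `m_i`. -/
theorem sum_polyVec_smul {M : Type*} [AddCommGroup M] [Module k M] (hs : 0 < orderOf χ)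
    (v : ℕ → M) :
    ∑ l : Fin (f.natDegree * orderOf χ), polyVec χ f l • v l =
      -∑ j ∈ Finset.range f.natDegree, f.coeff j • v (orderOf χ * j) := by
  let F : ℕ → M := fun l =>
    (if orderOf χ ∣ l then -f.coeff (l / orderOf χ) else 0) • v l
  have h1 : ∑ l : Fin (f.natDegree * orderOf χ), polyVec χ f l • v l =
      ∑ l ∈ Finset.range (f.natDegree * orderOf χ), F l :=
    Fin.sum_univ_eq_sum_range F _
  rw [h1, ← Finset.sum_neg_distrib]
  symm
  refine Finset.sum_of_injOn (fun j => orderOf χ * j) ?_ ?_ ?_ ?_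
  · intro i _ j _ hij
    exact Nat.eq_of_mul_eq_mul_left hs hij
  · intro j hj
    have hj : j < f.natDegree := by simpa using hj
    simp only [Finset.coe_range, Set.mem_Iio]
    rw [mul_comm]
    exact Nat.mul_lt_mul_of_pos_right hj hs
  · intro l hl hl'
    by_cases hd : orderOf χ ∣ l
    · obtain ⟨j, rfl⟩ := hd
      refine absurd ⟨j, ?_, rfl⟩ hl'
      have := Finset.mem_range.mp hl
      rw [mul_comm] at this
      simpa using Nat.lt_of_mul_lt_mul_right this
    · simp only [F, if_neg hd, zero_smul]
  · intro j _
    simp only [F, dvd_mul_right, if_true, Nat.mul_div_cancel_left _ hs, neg_smul]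

/-- For monic `f`, vanishing of `f(x^s) w` expresses `x^{ns} w` through lower powers. -/
theorem aeval_Y_smul_eq_zero_iff {M : Type*} [AddCommGroup M] [Module k M]
    [Module (HopfOre χ a) M] [IsScalarTower k (HopfOre χ a) M] (hf : f.Monic)
    (hs : 0 < orderOf χ) (w : M) :
    Polynomial.aeval (Y χ a) f • w = 0 ↔
      X χ a ^ (f.natDegree * orderOf χ) • w =
        ∑ l : Fin (f.natDegree * orderOf χ), polyVec χ f l • X χ a ^ (l : ℕ) • w := by
  rw [sum_polyVec_smul hs (fun l => X χ a ^ l • w), eq_neg_iff_add_eq_zero,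
    Polynomial.aeval_eq_sum_range, Finset.sum_range_succ, hf.coeff_natDegree, one_smul, ← pow_mul,
    add_smul, Finset.sum_smul, mul_comm f.natDegree, add_comm]
  simp only [smul_assoc, ← pow_mul]

theorem aeval_Y_smul_polyGen (hf : f.Monic) (h : 0 < f.natDegree * orderOf χ) :
    Polynomial.aeval (Y χ a) f • polyGen χ a ν f h = 0 := by
  rw [aeval_Y_smul_eq_zero_iff hf (Nat.pos_of_mul_pos_left h)]
  simp only [← polyBasis_eq]
  exact (X_pow_smul_polyGen h).trans
    ((Pi.basisFun k (Fin (f.natDegree * orderOf χ))).sum_repr (polyVec χ f)).symm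

/-- The universal property of `V(ν, f)`: it is generated by a vector of weight `ν` subject to the
single relation `f(x^s) m_0 = 0`. -/
theorem exists_polyMod_hom {M : Type*} [AddCommGroup M] [Module k M]
    [Module (HopfOre χ a) M] [IsScalarTower k (HopfOre χ a) M] (hf : f.Monic)
    (h : 0 < f.natDegree * orderOf χ) (w : M) (hw : ∀ g, of χ a g • w = ((ν g : kˣ) : k) • w)
    (hfw : Polynomial.aeval (Y χ a) f • w = 0) :
    ∃ φ : PolyMod χ a ν f →ₗ[HopfOre χ a] M, φ (polyGen χ a ν f h) = w := by
  let φ : PolyMod χ a ν f →ₗ[k] M :=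
    (polyBasis χ a ν f).constr k fun i => X χ a ^ (i : ℕ) • w
  have hφ : ∀ i, φ (polyBasis χ a ν f i) = X χ a ^ (i : ℕ) • w :=
    Module.Basis.constr_basis _ _ _
  have hφ' : ∀ i (hi : i < f.natDegree * orderOf χ),
      φ (X χ a ^ i • polyGen χ a ν f h) = X χ a ^ i • w := by
    intro i hi
    rw [← polyBasis_eq h ⟨i, hi⟩, hφ]
  have hg : ∀ g v, φ (of χ a g • v) = of χ a g • φ v := by
    refine fun g => map_smul_of_basis (polyBasis χ a ν f) φ _ fun i => ?_
    rw [hφ, of_smul_X_pow_smul hw, polyBasis_eq h, of_smul_X_pow_smul (of_smul_polyGen h),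
      map_smul, hφ' _ i.2]
  have hx : ∀ v, φ (X χ a • v) = X χ a • φ v := by
    refine map_smul_of_basis (polyBasis χ a ν f) φ _ fun i => ?_
    rw [hφ, polyBasis_eq h, ← mul_smul, ← mul_smul, ← pow_succ']
    by_cases hi : (i : ℕ) + 1 < f.natDegree * orderOf χ
    · exact hφ' _ hi
    · have hN : (i : ℕ) + 1 = f.natDegree * orderOf χ := by omega
      have hs := Nat.pos_of_mul_pos_left h
      rw [hN, (aeval_Y_smul_eq_zero_iff hf hs _).mp hfw,
        (aeval_Y_smul_eq_zero_iff hf hs _).mp (aeval_Y_smul_polyGen hf h), map_sum]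
      refine Finset.sum_congr rfl fun l _ => ?_
      rw [map_smul, hφ' _ l.2]
  have h0 : φ (polyGen χ a ν f h) = w := by simpa only [pow_zero, one_smul] using hφ' 0 h
  exact ⟨linearMapOfGenerators φ hg hx, h0⟩

theorem finrank_polyMod : Module.finrank k (PolyMod χ a ν f) = f.natDegree * orderOf χ := by
  rw [Module.finrank_eq_card_basis (polyBasis χ a ν f), Fintype.card_fin]

instance : Module.Finite k (PolyMod χ a ν f) := Module.Finite.of_basis (polyBasis χ a ν f)

end PolyMod

section JordanMod

open Polynomial in
theorem natDegree_X_sub_C_pow (n : ℕ) (β : k) :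
    ((Polynomial.X - C β) ^ n).natDegree = n := by
  rw [natDegree_pow, natDegree_X_sub_C, mul_one]

open Polynomial in
theorem aeval_Y_X_sub_C_pow (n : ℕ) (β : k) :
    aeval (Y χ a) ((Polynomial.X - C β) ^ n) = Ysub χ a β ^ n := by
  rw [map_pow, map_sub, aeval_X, aeval_C]

variable {n : ℕ} {ν : G →* kˣ} {β : k}

theorem jordan_dim_pos (hn : 0 < n) (hs : 0 < orderOf χ) :
    0 < ((Polynomial.X - Polynomial.C β) ^ n).natDegree * orderOf χ := by
  rw [natDegree_X_sub_C_pow]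
  exact Nat.mul_pos hn hs

/-- Linear span of the vectors `(x^s - β)^j x^l w`, `l < s`, contains all `x^i w`. -/
theorem X_pow_smul_mem_span_Ysub {M : Type*} [AddCommGroup M] [Module k M]
    [Module (HopfOre χ a) M] [IsScalarTower k (HopfOre χ a) M] (hs : 0 < orderOf χ) (β : k)
    (w : M) (i : ℕ) : X χ a ^ i • w ∈
      Submodule.span k {v | ∃ j l, l < orderOf χ ∧ v = Ysub χ a β ^ j • X χ a ^ l • w} := by
  have hY : ∀ r, ∀ l < orderOf χ, Y χ a ^ r • X χ a ^ l • w ∈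
      Submodule.span k {v | ∃ j l, l < orderOf χ ∧ v = Ysub χ a β ^ j • X χ a ^ l • w} := by
    intro r
    induction r with
    | zero =>
      intro l hl
      exact Submodule.subset_span ⟨0, l, hl, by simp⟩
    | succ r ih =>
      intro l hl
      rw [pow_succ', mul_smul]
      refine Submodule.span_induction (p := fun v _ => Y χ a • v ∈ _) ?_ ?_ ?_ ?_ (ih l hl)
      · rintro _ ⟨j, l, hl, rfl⟩
        have : Y χ a • Ysub χ a β ^ j • X χ a ^ l • w =
            Ysub χ a β ^ (j + 1) • X χ a ^ l • w + β • Ysub χ a β ^ j • X χ a ^ l • w := by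
          rw [pow_succ', mul_smul, ← algebraMap_smul (HopfOre χ a) β, ← add_smul, sub_add_cancel]
        rw [this]
        exact Submodule.add_mem _ (Submodule.subset_span ⟨_, _, hl, rfl⟩)
          (Submodule.smul_mem _ _ (Submodule.subset_span ⟨_, _, hl, rfl⟩))
      · rw [smul_zero]
        exact Submodule.zero_mem _
      · intro u v _ _ hu hv
        rw [smul_add]
        exact Submodule.add_mem _ hu hv
      · intro c v _ hv
        rw [smul_smul_comm]
        exact Submodule.smul_mem _ _ hv
  have := hY (i / orderOf χ) (i % orderOf χ) (Nat.mod_lt _ hs)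
  rwa [← mul_smul, ← pow_mul, ← pow_add, Nat.div_add_mod] at this

/-- Bijectivity of an `H`-linear surjection between spaces of the same dimension. -/
theorem nonempty_equiv_of_surjective {H : Type*} [Ring H] [Algebra k H] {M M' : Type*}
    [AddCommGroup M] [Module k M]
    [Module H M] [IsScalarTower k H M] [AddCommGroup M'] [Module k M']
    [Module H M'] [IsScalarTower k H M'] [Module.Finite k M] [Module.Finite k M']
    (φ : M →ₗ[H] M') (hφ : Function.Surjective φ)
    (h : Module.finrank k M = Module.finrank k M') : Nonempty (M ≃ₗ[H] M') := by
  have hs : Function.Surjective (φ.restrictScalars k) := hφ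
  have hi : Function.Injective φ :=
    (LinearMap.injective_iff_surjective_of_finrank_eq_finrank h).mpr hs
  exact ⟨LinearEquiv.ofBijective φ ⟨hi, hφ⟩⟩

theorem nonempty_jordanMod_zero_equiv_nilMod (hn : 0 < n) (hs : 0 < orderOf χ) :
    Nonempty (JordanMod χ a n ν 0 ≃ₗ[HopfOre χ a] NilMod χ a (n * orderOf χ) ν) := by
  have hN := Nat.mul_pos hn hs
  let w : NilMod χ a (n * orderOf χ) ν := (Pi.single ⟨0, hN⟩ 1 : Fin (n * orderOf χ) → k)
  have hw : ∀ g, of χ a g • w = ((ν g : kˣ) : k) • w :=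
    cyclicAct_of_single_zero ν 0 _ hN
  let b : Module.Basis (Fin (n * orderOf χ)) k (NilMod χ a (n * orderOf χ) ν) :=
    Pi.basisFun k (Fin (n * orderOf χ))
  have hb : ∀ i, b i = X χ a ^ (i : ℕ) • w := fun i =>
    (Pi.basisFun_apply k _ i).trans (cyclicAct_X_pow_single_zero ν 0 _ i).symm
  have h0 : X χ a ^ (n * orderOf χ) • w = 0 := cyclicAct_X_pow_single_zero_top ν 0 _ hN
  obtain ⟨φ, hφ⟩ := exists_polyMod_hom (ν := ν) ((Polynomial.monic_X_sub_C (0 : k)).pow n)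
    (jordan_dim_pos hn hs) w hw (by
      rw [aeval_Y_X_sub_C_pow, Ysub, map_zero, sub_zero, Y, ← pow_mul,
        mul_comm (orderOf χ) n, h0])
  have : Module.Finite k (NilMod χ a (n * orderOf χ) ν) := Module.Finite.of_basis b
  refine nonempty_equiv_of_surjective (k := k) φ ?_ ?_
  · have h : (⊤ : Submodule k _) ≤ (LinearMap.range φ).restrictScalars k := by
      rw [← b.span_eq, Submodule.span_le]
      rintro _ ⟨i, rfl⟩
      exact ⟨X χ a ^ (i : ℕ) • polyGen χ a ν _ (jordan_dim_pos hn hs), by rw [map_smul, hφ, hb]⟩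
    exact fun v => h (Submodule.mem_top (x := v))
  · rw [finrank_polyMod, natDegree_X_sub_C_pow, Module.finrank_eq_card_basis b, Fintype.card_fin]

end JordanMod

end Modules

end HopfOre

/-! ### Tensor products of non-nilpotent modules -/

namespace BialgTensor

variable {k H V W : Type*} [CommRing k] [Ring H] [Bialgebra k H]
    [AddCommGroup V] [Module k V] [Module H V] [IsScalarTower k H V]
    [AddCommGroup W] [Module k W] [Module H W] [IsScalarTower k H W]

variable (k H V W) in
/-- The bilinear map `(v, w) ↦ v ⊗ w` into the tensor product of `H`-modules. -/
def mk : V →ₗ[k] W →ₗ[k] BialgTensor k H V W := TensorProduct.mk k V W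

theorem act_tmul {h : H} {z : H ⊗[k] H} (hz : Coalgebra.comul (R := k) h = z) (v : V) (w : W) :
    h • mk k H V W v w =
      Module.endTensorEndAlgHom (R := k) (S := k) (A := k) (M := V) (N := W)
        (Algebra.TensorProduct.map (Algebra.lsmul k k V) (Algebra.lsmul k k W) z)
        (v ⊗ₜ[k] w) := by
  subst hz
  rfl

theorem smul_mk_of_comul_eq_tmul {h h₁ h₂ : H} (hz : Coalgebra.comul (R := k) h = h₁ ⊗ₜ[k] h₂)
    (v : V) (w : W) : h • mk k H V W v w = mk k H V W (h₁ • v) (h₂ • w) :=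
  act_tmul hz v w

theorem smul_mk_of_comul_eq_add {h h₁ h₂ h₃ h₄ : H}
    (hz : Coalgebra.comul (R := k) h = h₁ ⊗ₜ[k] h₂ + h₃ ⊗ₜ[k] h₄)
    (v : V) (w : W) : h • mk k H V W v w =
      mk k H V W (h₁ • v) (h₂ • w) + mk k H V W (h₃ • v) (h₄ • w) := by
  rw [act_tmul hz, map_add, map_add, LinearMap.add_apply]
  rfl

theorem span_mk (S : Submodule k (BialgTensor k H V W)) (h : ∀ v w, mk k H V W v w ∈ S) :
    S = ⊤ := by
  rw [eq_top_iff]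
  intro z _
  induction z using TensorProduct.induction_on with
  | zero => exact S.zero_mem
  | tmul v w => exact h v w
  | add x y hx hy => exact S.add_mem (hx trivial) (hy trivial)

end BialgTensor

namespace HopfOre

variable {k G : Type*} [Field k] [Group G] {χ : G →* kˣ} {a : Subgroup.center G}

/-- `Δ(x^s) = x^s ⊗ a^s + 1 ⊗ x^s`, since `χ⁻¹(a)` is a primitive `s`-th root of unity. -/
theorem comul_Y (hs : 0 < orderOf χ) (hq : IsPrimitiveRoot (χ⁻¹ (a : G)) (orderOf χ)) :
    Coalgebra.comul (R := k) (Y χ a) =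
      Y χ a ⊗ₜ[k] (of χ a a ^ orderOf χ) + 1 ⊗ₜ[k] Y χ a := by
  have hq' : IsPrimitiveRoot ((χ⁻¹ (a : G) : kˣ) : k) (orderOf χ) :=
    IsPrimitiveRoot.coe_units_iff.mpr hq
  rw [Y, Bialgebra.comul_pow, comul_X, add_pow_of_qCommute_of_isPrimitiveRoot _ hq' hs,
    Algebra.TensorProduct.tmul_pow, Algebra.TensorProduct.tmul_pow, one_pow]
  rw [Algebra.TensorProduct.tmul_mul_tmul, Algebra.TensorProduct.tmul_mul_tmul, one_mul, mul_one,
    X_mul_of, TensorProduct.tmul_smul]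

theorem jordan_span {n : ℕ} {ν : G →* kˣ} {β : k}
    (h : 0 < ((Polynomial.X - Polynomial.C β) ^ n).natDegree * orderOf χ)
    (S : Submodule k (JordanMod χ a n ν β)) (hS : ∀ i : ℕ, X χ a ^ i • polyGen χ a ν _ h ∈ S) :
    S = ⊤ := by
  rw [eq_top_iff, ← (polyBasis χ a ν _).span_eq, Submodule.span_le]
  rintro _ ⟨i, rfl⟩
  rw [polyBasis_eq h]
  exact hS i

section Tensor

/-- `a^s` acts on `V_n(μ, β)` by the scalar `μ^s(a)`. -/
theorem of_center_pow_smul {n : ℕ} {μ : G →* kˣ} {β : k} (hn : 0 < n) (hs : 0 < orderOf χ)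
    (w : JordanMod χ a n μ β) :
    of χ a a ^ orderOf χ • w = ((μ a : kˣ) : k) ^ orderOf χ • w := by
  have h := jordan_dim_pos (β := β) hn hs
  have key : Algebra.lsmul k k (JordanMod χ a n μ β) (of χ a a ^ orderOf χ) =
      ((μ a : kˣ) : k) ^ orderOf χ • LinearMap.id := by
    refine (polyBasis χ a μ _).ext fun i => ?_
    rw [polyBasis_eq h, LinearMap.smul_apply, LinearMap.id_apply]
    change of χ a a ^ orderOf χ • X χ a ^ (i : ℕ) • polyGen χ a μ _ h = _
    have hpow : ∀ m : ℕ, of χ a a ^ m • X χ a ^ (i : ℕ) • polyGen χ a μ _ h =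
        (((χ ^ (i : ℕ) * μ) a : kˣ) : k) ^ m • X χ a ^ (i : ℕ) • polyGen χ a μ _ h := by
      intro m
      induction m with
      | zero => rw [pow_zero, pow_zero, one_smul, one_smul]
      | succ m ih =>
        rw [pow_succ', mul_smul, ih, smul_smul_comm, of_smul_X_pow_smul (of_smul_polyGen h),
          smul_smul, pow_succ]
    rw [hpow, ← Units.val_pow_eq_pow_val, MonoidHom.mul_apply, mul_pow, MonoidHom.pow_apply,
      pow_right_comm, chi_pow_orderOf, one_pow, one_mul, Units.val_pow_eq_pow_val]
  exact LinearMap.congr_fun key w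

variable {p t : ℕ} {σ μ : G →* kˣ} {α β : k}

theorem Ysub_smul_mk (ht : 0 < t) (hs : 0 < orderOf χ)
    (hq : IsPrimitiveRoot (χ⁻¹ (a : G)) (orderOf χ))
    (v : JordanMod χ a p σ α) (w : JordanMod χ a t μ β) :
    Ysub χ a (α * ((μ a : kˣ) : k) ^ orderOf χ + β) • BialgTensor.mk k (HopfOre χ a) _ _ v w =
      ((μ a : kˣ) : k) ^ orderOf χ • BialgTensor.mk k (HopfOre χ a) _ _ (Ysub χ a α • v) w +
        BialgTensor.mk k (HopfOre χ a) _ _ v (Ysub χ a β • w) := by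
  rw [Ysub, sub_smul, BialgTensor.smul_mk_of_comul_eq_add (comul_Y hs hq), of_center_pow_smul ht hs,
    one_smul, sub_smul, sub_smul, algebraMap_smul, algebraMap_smul, algebraMap_smul, map_sub,
    map_sub, LinearMap.sub_apply]
  simp only [map_smul, LinearMap.smul_apply]
  module

/-- The vectors of weight `χ^l σ μ` in `V ⊗ W` that form the tensor product of a Jordan block of
size `p` with one of size `t`. They are normalised so that `x^s - γ` acts as the sum of the two
shifts. -/
noncomputable def stringVec (χ : G →* kˣ) (a : Subgroup.center G) (σ μ : G →* kˣ) {p t : ℕ}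
    {α β : k} (hp : 0 < p) (ht : 0 < t) (hs : 0 < orderOf χ) (l i j : ℕ) :
    BialgTensor k (HopfOre χ a) (JordanMod χ a p σ α) (JordanMod χ a t μ β) :=
  (((μ a : kˣ) : k) ^ orderOf χ) ^ i • BialgTensor.mk k (HopfOre χ a) _ _
    (Ysub χ a α ^ i • polyGen χ a σ _ (jordan_dim_pos hp hs))
    (Ysub χ a β ^ j • X χ a ^ l • polyGen χ a μ _ (jordan_dim_pos ht hs))

theorem of_smul_stringVec (hp : 0 < p) (ht : 0 < t) (hs : 0 < orderOf χ) (l i j : ℕ) (g : G) :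
    of χ a g • stringVec χ a σ μ (α := α) (β := β) hp ht hs l i j =
      (((χ ^ l * σ * μ) g : kˣ) : k) • stringVec χ a σ μ (α := α) (β := β) hp ht hs l i j := by
  rw [stringVec, smul_smul_comm, BialgTensor.smul_mk_of_comul_eq_tmul (comul_of χ a g),
    ← mul_smul, ← ((commute_Ysub_of α g).pow_left i).eq, mul_smul, of_smul_polyGen, ← mul_smul,
    ← ((commute_Ysub_of β g).pow_left j).eq, mul_smul, of_smul_X_pow_smul (of_smul_polyGen _),
    smul_smul_comm, smul_smul_comm, (BialgTensor.mk k _ _ _).map_smul, LinearMap.smul_apply,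
    LinearMap.map_smul]
  simp only [smul_smul, MonoidHom.mul_apply, Units.val_mul]
  congr 1
  ring

/-- Clebsch–Gordan for the action of `x^s` on the weight `χ^l σ μ` part of `m_0 k[x^s] ⊗ W`. -/
theorem exists_strings [CharZero k] (hp : 0 < p) (ht : 0 < t) (hs : 0 < orderOf χ)
    (hq : IsPrimitiveRoot (χ⁻¹ (a : G)) (orderOf χ)) (l : ℕ) :
    ∃ u : ℕ → BialgTensor k (HopfOre χ a) (JordanMod χ a p σ α) (JordanMod χ a t μ β),
      (∀ d < min p t, (∀ g, of χ a g • u d = (((χ ^ l * σ * μ) g : kˣ) : k) • u d) ∧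
        Ysub χ a (α * ((μ a : kˣ) : k) ^ orderOf χ + β) ^ (p + t - 1 - 2 * d) • u d = 0) ∧
      ∀ i j, stringVec χ a σ μ hp ht hs l i j ∈ Submodule.span k {v | ∃ d m, d < min p t ∧
        v = Ysub χ a (α * ((μ a : kˣ) : k) ^ orderOf χ + β) ^ m • u d} := by
  have hV : ∀ i, p ≤ i → Ysub χ a α ^ i • polyGen χ a σ _ (jordan_dim_pos (β := α) hp hs) = 0 := by
    intro i hi
    rw [← Nat.sub_add_cancel hi, pow_add, mul_smul, ← aeval_Y_X_sub_C_pow p,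
      aeval_Y_smul_polyGen ((Polynomial.monic_X_sub_C α).pow p), smul_zero]
  have hW : ∀ j, t ≤ j → Ysub χ a β ^ j • X χ a ^ l •
      polyGen χ a μ _ (jordan_dim_pos (β := β) ht hs) = 0 := by
    intro j hj
    rw [← mul_smul, (((commute_Ysub_X β).pow_left j).pow_right l).eq, mul_smul,
      ← Nat.sub_add_cancel hj, pow_add, mul_smul, ← aeval_Y_X_sub_C_pow t,
      aeval_Y_smul_polyGen ((Polynomial.monic_X_sub_C β).pow t), smul_zero, smul_zero]
  obtain ⟨u, h1, h2⟩ := clebschGordan (k := k) hp ht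
    (Algebra.lsmul k k (BialgTensor k (HopfOre χ a) (JordanMod χ a p σ α) (JordanMod χ a t μ β))
      (Ysub χ a (α * ((μ a : kˣ) : k) ^ orderOf χ + β)))
    (stringVec χ a σ μ hp ht hs l)
    (by
      rintro i j (h | h)
      · rw [stringVec, hV i h, map_zero, LinearMap.zero_apply, smul_zero]
      · rw [stringVec, hW j h, map_zero, smul_zero])
    (by
      intro i j
      change Ysub χ a (α * ((μ a : kˣ) : k) ^ orderOf χ + β) • stringVec χ a σ μ hp ht hs l i j = _
      rw [stringVec, smul_smul_comm, Ysub_smul_mk ht hs hq, smul_add, smul_smul,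
        ← pow_succ, ← mul_smul (Ysub χ a α), ← pow_succ', ← mul_smul (Ysub χ a β), ← pow_succ']
      rfl)
  simp only [← map_pow, Algebra.lsmul_coe] at h1 h2
  refine ⟨u, fun d hd => ⟨fun g => ?_, (h1 d hd).2⟩, h2⟩
  refine Submodule.span_induction
    (p := fun v _ => of χ a g • v = (((χ ^ l * σ * μ) g : kˣ) : k) • v) ?_ ?_ ?_ ?_ (h1 d hd).1
  · rintro _ ⟨i, j, rfl⟩
    exact of_smul_stringVec hp ht hs l i j g
  · rw [smul_zero, smul_zero]
  · intro v w _ _ hv hw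
    rw [smul_add, smul_add, hv, hw]
  · intro c v _ hv
    rw [smul_smul_comm, hv, smul_comm]

/-- An `H`-submodule of `V ⊗ W` that contains `m_0 ⊗ (x^s - β)^j m_l` for all `j` and all `l < s`
is everything: it contains `m_0 ⊗ W`, and `x (m_i ⊗ w) = m_{i+1} ⊗ a w + m_i ⊗ x w` with `a`
invertible. -/
theorem eq_top_of_stringVec_mem (hp : 0 < p) (ht : 0 < t) (hs : 0 < orderOf χ)
    (R : Submodule (HopfOre χ a)
      (BialgTensor k (HopfOre χ a) (JordanMod χ a p σ α) (JordanMod χ a t μ β)))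
    (hR : ∀ l < orderOf χ, ∀ j, stringVec χ a σ μ hp ht hs l 0 j ∈ R) : R = ⊤ := by
  let B := BialgTensor.mk k (HopfOre χ a) (JordanMod χ a p σ α) (JordanMod χ a t μ β)
  let m₀ : JordanMod χ a p σ α := polyGen χ a σ _ (jordan_dim_pos hp hs)
  have hVW : ∀ (i : ℕ) (w : JordanMod χ a t μ β), B (X χ a ^ i • m₀) w ∈ R := by
    intro i
    induction i with
    | zero =>
      intro w
      have : ((R.restrictScalars k).comap (B (X χ a ^ 0 • m₀))) = ⊤ := by
        refine jordan_span (jordan_dim_pos ht hs) _ fun i => ?_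
        refine Submodule.span_le.mpr ?_ (X_pow_smul_mem_span_Ysub hs β _ i)
        rintro _ ⟨j, l, hl, rfl⟩
        have := hR l hl j
        rw [stringVec, pow_zero, pow_zero, one_smul, one_smul] at this
        rw [pow_zero, one_smul]
        exact this
      have hw : w ∈ ((R.restrictScalars k).comap (B (X χ a ^ 0 • m₀))) := this ▸ trivial
      exact hw
    | succ i ih =>
      intro w
      have h1 := R.smul_mem (X χ a) (ih (of χ a (a : G)⁻¹ • w))
      rw [BialgTensor.smul_mk_of_comul_eq_add (comul_X χ a), one_smul, ← mul_smul, ← pow_succ',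
        ← mul_smul, of_mul, mul_inv_cancel, of_one, one_smul] at h1
      exact (Submodule.add_mem_iff_left R (ih _)).mp h1
  have htop : R.restrictScalars k = ⊤ := by
    refine BialgTensor.span_mk _ fun v w => ?_
    have : (R.restrictScalars k).comap (B.flip w) = ⊤ :=
      jordan_span (jordan_dim_pos hp hs) _ fun i => hVW i w
    have hv : v ∈ (R.restrictScalars k).comap (B.flip w) := this ▸ trivial
    exact hv
  rw [eq_top_iff]
  intro z _
  have : z ∈ R.restrictScalars k := htop ▸ trivial
  exact this

end Tensor

end HopfOre

/-- The sizes of the Jordan blocks in the Clebsch–Gordan rule add up to `p * t`. -/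
theorem sum_clebschGordan_sizes (p t : ℕ) :
    ∑ j : Finset.Icc 1 (min p t), (2 * (j : ℕ) - 1 + ((p : ℤ) - (t : ℤ)).natAbs) = p * t := by
  rw [Finset.sum_coe_sort (Finset.Icc 1 (min p t))
    (fun j => 2 * j - 1 + ((p : ℤ) - (t : ℤ)).natAbs), ← sum_clebschGordan_dims p t,
    Fin.sum_univ_eq_sum_range (fun d => p + t - 1 - 2 * d) (min p t)]
  refine Finset.sum_nbij' (fun j => min p t - j) (fun d => min p t - d) ?_ ?_ ?_ ?_ ?_ <;>
    simp only [Finset.mem_Icc, Finset.mem_range] <;> intros <;> omega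

theorem theorem3p7 {k : Type*} [Field k] [IsAlgClosed k] [CharZero k] {G : Type*} [Group G]
    (χ : G →* kˣ) (a : Subgroup.center G) (hχa : χ a ≠ 1)
    (s : ℕ) (hs : 0 < s) (hχ : orderOf χ = s) (hq : IsPrimitiveRoot (χ⁻¹ (a : G)) s)
    (p t : ℕ) (hp : 1 ≤ p) (ht : 1 ≤ t) (σ μ : G →* kˣ) (α β : k) (hα : α ≠ 0) (hβ : β ≠ 0) :
    Nonempty
      (BialgTensor k (HopfOre χ a) (HopfOre.JordanMod χ a p σ α) (HopfOre.JordanMod χ a t μ β)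
        ≃ₗ[HopfOre χ a]
      ⨁ (i : Fin s) (j : Finset.Icc 1 (min p t)),
        HopfOre.JordanMod χ a (2 * (j : ℕ) - 1 + ((p : ℤ) - (t : ℤ)).natAbs)
          (χ ^ (i : ℕ) * σ * μ) (α * (((μ ^ s) (a : G) : kˣ) : k) + β)) ∧
    (α * (((μ ^ s) (a : G) : kˣ) : k) + β = 0 →
      ∀ (i : Fin s) (j : Finset.Icc 1 (min p t)),
        Nonempty
          (HopfOre.JordanMod χ a (2 * (j : ℕ) - 1 + ((p : ℤ) - (t : ℤ)).natAbs)
            (χ ^ (i : ℕ) * σ * μ) (α * (((μ ^ s) (a : G) : kˣ) : k) + β)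
            ≃ₗ[HopfOre χ a]
          HopfOre.NilMod χ a ((2 * (j : ℕ) - 1 + ((p : ℤ) - (t : ℤ)).natAbs) * s)
            (χ ^ (i : ℕ) * σ * μ))) := by
  subst hχ
  set c : k := ((μ (a : G) : kˣ) : k) ^ orderOf χ
  have hc' : (((μ ^ orderOf χ) (a : G) : kˣ) : k) = c := by
    rw [MonoidHom.pow_apply, Units.val_pow_eq_pow_val]
  rw [hc']
  have hn : ∀ j : Finset.Icc 1 (min p t), 0 < 2 * (j : ℕ) - 1 + ((p : ℤ) - (t : ℤ)).natAbs := by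
    intro j
    have := (Finset.mem_Icc.mp j.2).1
    omega
  refine ⟨?_, fun h0 i j => ?_⟩
  · choose u hu hspan using
      HopfOre.exists_strings (σ := σ) (μ := μ) (α := α) (β := β) hp ht hs hq
    have hφ : ∀ (i : Fin (orderOf χ)) (j : Finset.Icc 1 (min p t)),
        ∃ φ : HopfOre.JordanMod χ a (2 * (j : ℕ) - 1 + ((p : ℤ) - (t : ℤ)).natAbs)
          (χ ^ (i : ℕ) * σ * μ) (α * c + β) →ₗ[HopfOre χ a]
          BialgTensor k (HopfOre χ a) (HopfOre.JordanMod χ a p σ α) (HopfOre.JordanMod χ a t μ β),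
          φ (HopfOre.polyGen χ a _ _ (HopfOre.jordan_dim_pos (hn j) hs)) =
            u i (min p t - j) := by
      intro i j
      have hj := Finset.mem_Icc.mp j.2
      obtain ⟨hw, hz⟩ := hu i (min p t - j) (by omega)
      refine HopfOre.exists_polyMod_hom ((Polynomial.monic_X_sub_C _).pow _) _ _ hw ?_
      rw [HopfOre.aeval_Y_X_sub_C_pow, ← hz]
      congr 2
      omega
    choose φ hφ using hφ
    let Φ := DirectSum.toModule (HopfOre χ a) (Fin (orderOf χ)) _ fun i =>
      DirectSum.toModule (HopfOre χ a) (Finset.Icc 1 (min p t)) _ fun j => φ i j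
    have hΦ : LinearMap.range Φ = ⊤ := by
      refine HopfOre.eq_top_of_stringVec_mem hp ht hs _ fun l hl j => ?_
      have hmem : ∀ d < min p t, u l d ∈ LinearMap.range Φ := by
        intro d hd
        let j : Finset.Icc 1 (min p t) := ⟨min p t - d, Finset.mem_Icc.mpr (by omega)⟩
        refine ⟨DirectSum.lof (HopfOre χ a) _ _ (⟨l, hl⟩ : Fin (orderOf χ))
          (DirectSum.lof (HopfOre χ a) _ _ j
            (HopfOre.polyGen χ a _ _ (HopfOre.jordan_dim_pos (hn j) hs))), ?_⟩
        rw [DirectSum.toModule_lof, DirectSum.toModule_lof, hφ]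
        congr 1
        simp only [j]
        omega
      refine (Submodule.span_le (p := (LinearMap.range Φ).restrictScalars k)).mpr ?_ (hspan l 0 j)
      rintro _ ⟨d, m, hd, rfl⟩
      exact (LinearMap.range Φ).smul_mem _ (hmem d hd)
    have : Module.Finite k (BialgTensor k (HopfOre χ a) (HopfOre.JordanMod χ a p σ α)
        (HopfOre.JordanMod χ a t μ β)) :=
      inferInstanceAs (Module.Finite k
        (HopfOre.JordanMod χ a p σ α ⊗[k] HopfOre.JordanMod χ a t μ β))
    obtain ⟨e⟩ := HopfOre.nonempty_equiv_of_surjective (k := k) Φ (LinearMap.range_eq_top.mp hΦ) (by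
      have e1 : Module.finrank k (BialgTensor k (HopfOre χ a) (HopfOre.JordanMod χ a p σ α)
          (HopfOre.JordanMod χ a t μ β)) = (p * orderOf χ) * (t * orderOf χ) := by
        refine (Module.finrank_tensorProduct (R := k) (S := k) (M := HopfOre.JordanMod χ a p σ α)
          (M' := HopfOre.JordanMod χ a t μ β)).trans ?_
        rw [HopfOre.finrank_polyMod, HopfOre.finrank_polyMod, HopfOre.natDegree_X_sub_C_pow,
          HopfOre.natDegree_X_sub_C_pow]
      rw [e1, Module.finrank_directSum]
      simp only [Module.finrank_directSum, HopfOre.finrank_polyMod, HopfOre.natDegree_X_sub_C_pow]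
      rw [← Finset.sum_mul, sum_clebschGordan_sizes, Finset.sum_const, Finset.card_univ,
        Fintype.card_fin, smul_eq_mul]
      ring)
    exact ⟨e.symm⟩
  · rw [h0]
    exact HopfOre.nonempty_jordanMod_zero_equiv_nilMod (hn j) hs
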